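/- **Setting.** Let $\mathcal H$ be a complex Hilbert space, $\Theta\subset\mathbb R^m$ open, and $\theta\mapsto\varphi(\theta)\in\mathcal H$ a differentiable family of unit vectors on $\Theta$ (an $m$-parameter pure-state model $\rho(\theta)=|\varphi(\theta)\rangle\langle\varphi(\theta)|$). Fix $\theta\in\Theta$, write $\varphi=\varphi(\theta)$, and let $l_i=2(\partial_i\varphi-\langle\varphi|\partial_i\varphi\rangle\varphi)$ be the horizontal lift of $\partial/\partial\theta^i$, i.e. the unique vector with $\partial_i\rho(\theta)=\tfrac12(|l_i\rangle\langle\varphi|+|\varphi\rangle\langle l_i|)$ and $\langle l_i|\varphi\rangle=0$. A measurement $M$ is a positive operator valued measure on $\mathbb R^m$ with $M(\mathbb R^m)=I$; it is simple if it is projection valued. Let $\psi$ be a unit vector and $L=[k_1,\dots,k_m]$ a system of vectors orthogonal to $\psi$. The law of the outcome in the state $\psi$ is $\langle\psi|M(\cdot)\psi\rangle$. When its second moments are finite, put $V[M]=\big[\int(\hat\theta^i-\theta^i)(\hat\theta^j-\theta^j)\langle\psi|M(d\hat\theta)|\psi\rangle\big]$ and let $x^i=\int(\hat\theta^i-\theta^i)M(d\hat\theta)\psi$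 (weak integral) be the estimation vectors. $M$ is locally unbiased at $\theta$ with respect to $(\psi,L)$ if its second moments in the state $\psi$ are finite, $\langle\psi|x^i\rangle=0$ and $\mathrm{Re}\langle x^i|k_j\rangle=\delta^i_j$ for all $i,j$. For $(\psi,L)=(\varphi,[l_1,\dots,l_m])$ we say simply that $M$ is locally unbiased at $\theta$. Let $\mathcal V$ be the set of all $V[M]$, in the state $\varphi$, with $M$ a measurement in $\mathcal H$ locally unbiased at $\theta$. **Theorem (reduction theorem).** (0) If the second moments of the outcome of $M$ in the states $\varphi(\eta)$ are finite and bounded for $\eta$ near $\theta$, then $M$ is locally unbiased at $\theta$ if and only if $E_\theta[M]=\theta$ and $\partial_j (E_\theta[M])^i=\delta^i_j$ for all $i,j$, where $E_\eta[M]=\int\hat\theta\,\langle\varphi(\eta)|M(d\hat\theta)|\varphi(\eta)\rangle$ (the expectations existing for $\eta$ near $\theta$). (1) There are vectors $\varphi',l'_1,\dots,l'_m$ in $\mathbb C^{2m+1}$ with $$\langle\varphi'|\varphi'\rangle=1,\qquad \langle\varphi'|l'_j\rangle=0,\qquad \langle l'_i|l'_j\rangle=\langle l_i|l_j\rangle\qquad(i,j=1,\dots,m).\tag{$*$}$$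 Let now $\mathcal K_\theta$ be any $(2m+1)$-dimensional complex Hilbert space and $\varphi',l'_1,\dots,l'_m\in\mathcal K_\theta$ vectors satisfying $(*)$. (2) For every measurement $M$ in $\mathcal H$ that is locally unbiased at $\theta$ there is a simple measurement $E$ in $\mathcal K_\theta$ that is locally unbiased at $\theta$ with respect to $(\varphi',[l'_1,\dots,l'_m])$ and whose covariance matrix in the state $\varphi'$ equals that of $M$: $V[E]=V[M]$. (3) Consequently $$\mathcal V=\big\{\mathrm{Re}\,X^*X \;:\; X=[x^1,\dots,x^m],\ x^i\in\mathcal K_\theta,\ \langle x^i|\varphi'\rangle=0,\ \mathrm{Im}\,X^*X=0,\ \mathrm{Re}\,X^*L'=I_m\big\},$$ where $X^*Y=[\langle x^i|y^j\rangle]$ and $L'=[l'_1,\dots,l'_m]$; the same set is obtained when only the measurements $M$ satisfying the hypothesis and the derivative conditions of (0) are admitted in $\mathcal V$. In particular, for every real symmetric nonnegative definite $G$, minimizing $\mathrm{Tr}\,GV$ over $V\in\mathcal V$ is the same problem as minimizing $\mathrm{Tr}\,G\,\mathrm{Re}\,X^*X$ over these systems $X$: one minimum exists if and only if the other does, and then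 they are equal. -/

import Mathlib

open MeasureTheory Filter Topology

namespace QEst

universe u

noncomputable section

/-- A measurement (positive operator valued measure) on the measurable space `Ω` with values in the
bounded operators on `H`: `M(∅) = 0`, `M(Ω) = 1`, every `M(B)` is a nonnegative Hermitian operator,
and `M` is countably additive in the strong operator topology.
The values on non-measurable sets are irrelevant. -/
structure POVM (Ω : Type*) [MeasurableSpace Ω] (H : Type*) [NormedAddCommGroup H]
    [InnerProductSpace ℂ H] where
  op : Set Ω → H →L[ℂ] H
  op_empty : op ∅ = 0
  op_univ : op Set.univ = 1
  isPositive : ∀ B : Set Ω, MeasurableSet B → (op B).IsPositive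
  hasSum : ∀ B : ℕ → Set Ω, (∀ n, MeasurableSet (B n)) → Pairwise (Function.onFun Disjoint B) →
    ∀ ψ : H, HasSum (fun n => op (B n) ψ) (op (⋃ n, B n) ψ)

namespace POVM

variable {Ω : Type*} [MeasurableSpace Ω] {H : Type u} [NormedAddCommGroup H]
  [InnerProductSpace ℂ H]

/-- A measurement is simple if it is projection valued
(the operators `M(B)` are Hermitian by definition). -/
def IsSimple (M : POVM Ω H) : Prop :=
  ∀ B : Set Ω, MeasurableSet B → M.op B * M.op B = M.op B

open Classical in
/-- The complex measure `B ↦ ⟨ψ| M(B) χ⟩`. -/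
def complexMeasure (M : POVM Ω H) (ψ χ : H) : VectorMeasure Ω ℂ where
  measureOf' B := if MeasurableSet B then inner ℂ ψ (M.op B χ) else 0
  empty' := by simp [M.op_empty]
  not_measurable' B hB := by simp [hB]
  m_iUnion' B hB hd := by
    have h := (M.hasSum B hB hd χ).mapL (innerSL ℂ ψ)
    simpa [hB, MeasurableSet.iUnion hB] using h

theorem complexMeasure_apply (M : POVM Ω H) (ψ χ : H) {B : Set Ω} (hB : MeasurableSet B) :
    M.complexMeasure ψ χ B = inner ℂ ψ (M.op B χ) := by
  classical
  exact if_pos hB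

/-- The law `B ↦ ⟨ψ| M(B) ψ⟩ = tr |ψ⟩⟨ψ| M(B)` of the outcome of `M` in the pure state `ψ`. -/
def law (M : POVM Ω H) (ψ : H) : Measure Ω :=
  Measure.ofMeasurable (fun B _ => ENNReal.ofReal (inner ℂ ψ (M.op B ψ)).re)
    (by simp [M.op_empty])
    (by
      intro B hB hd
      have h := Complex.hasSum_re ((M.hasSum B hB hd ψ).mapL (innerSL ℂ ψ))
      simp only [innerSL_apply_apply] at h
      rw [← h.tsum_eq, ENNReal.ofReal_tsum_of_nonneg _ h.summable]
      exact fun n => (M.isPositive _ (hB n)).re_inner_nonneg_right ψ)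

theorem law_apply (M : POVM Ω H) (ψ : H) {B : Set Ω} (hB : MeasurableSet B) :
    M.law ψ B = ENNReal.ofReal (inner ℂ ψ (M.op B ψ)).re :=
  Measure.ofMeasurable_apply B hB

variable {m : ℕ}

/-- The outcome of `M` (an estimate in `ℝ^m`) has finite second moments in the state `ψ`. -/
def HasFiniteSecondMoments (M : POVM (Fin m → ℝ) H) (ψ : H) : Prop :=
  ∀ i, Integrable (fun ω => ω i ^ 2) (M.law ψ)

/-- The expectation of the `i`-th coordinate of the estimate in the state `ψ`. -/
def mean (M : POVM (Fin m → ℝ) H) (ψ : H) (i : Fin m) : ℝ :=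
  ∫ ω, ω i ∂(M.law ψ)

/-- The covariance matrix of the estimate about `θ` in the state `ψ`. -/
def cov (M : POVM (Fin m → ℝ) H) (θ : Fin m → ℝ) (ψ : H) : Matrix (Fin m) (Fin m) ℝ :=
  Matrix.of fun i j => ∫ ω, (ω i - θ i) * (ω j - θ j) ∂(M.law ψ)

/-- `x` is the estimation vector `∫ (ω i - θ i) M(dω) ψ`, the integral being understood weakly:
`⟨χ|x⟩ = ∫ (ω i - θ i) ⟨χ| M(dω) ψ⟩` for all `χ`. -/
def IsEstimationVector (M : POVM (Fin m → ℝ) H) (θ : Fin m → ℝ) (ψ : H) (i : Fin m)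
    (x : H) : Prop :=
  ∀ χ : H, (M.complexMeasure χ ψ).Integrable (fun ω => ω i - θ i) ∧
    inner ℂ χ x = VectorMeasure.integral (M.complexMeasure χ ψ) (fun ω => ω i - θ i)
      (ContinuousLinearMap.lsmul ℝ ℝ)

/-- Local unbiasedness of `M` with respect to the state vector `ψ` and the horizontal lifts `l j`:
the second moments are finite and the estimation vectors `x i` satisfy
`⟨ψ|x i⟩ = 0` and `Re ⟨l j|x i⟩ = δ i j`. -/
def IsLocallyUnbiased (M : POVM (Fin m → ℝ) H) (θ : Fin m → ℝ) (ψ : H) (l : Fin m → H) : Prop :=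
  M.HasFiniteSecondMoments ψ ∧
    ∃ x : Fin m → H, (∀ i, M.IsEstimationVector θ ψ i (x i)) ∧
      (∀ i, inner ℂ ψ (x i) = 0) ∧
      ∀ i j, (inner ℂ (l j) (x i)).re = if i = j then 1 else 0

/-- Local unbiasedness at `θ` in terms of the model `φ`: the expectation exists near `θ`, equals `θ`
at `θ`, and its partial derivatives at `θ` are `∂_j E[ω i] = δ i j`. -/
def IsLocallyUnbiasedInMean (M : POVM (Fin m → ℝ) H) (φ : (Fin m → ℝ) → H)
    (θ : Fin m → ℝ) : Prop :=
  (∀ᶠ η in 𝓝 θ, ∀ i, Integrable (fun ω => ω i) (M.law (φ η))) ∧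
    (∀ i, M.mean (φ θ) i = θ i) ∧
    ∀ i j, HasDerivAt (fun t : ℝ => M.mean (φ (θ + t • Pi.single j 1)) i)
      (if i = j then 1 else 0) 0

/-- The second moments of the estimate are finite and bounded for parameters near `θ`. -/
def HasLocallyBoundedSecondMoments (M : POVM (Fin m → ℝ) H) (φ : (Fin m → ℝ) → H)
    (θ : Fin m → ℝ) : Prop :=
  ∃ C : ℝ, ∀ᶠ η in 𝓝 θ, M.HasFiniteSecondMoments (φ η) ∧ ∀ i, ∫ ω, ω i ^ 2 ∂(M.law (φ η)) ≤ C

end POVM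

variable {H : Type u} [NormedAddCommGroup H] [InnerProductSpace ℂ H] {m : ℕ}

/-- The horizontal lift `l_j = 2 (∂_j φ - ⟨φ|∂_j φ⟩ φ)` of `∂/∂θ^j` at `φ(θ)`. It is the unique
vector with `∂_j |φ⟩⟨φ| = (|l_j⟩⟨φ| + |φ⟩⟨l_j|) / 2` and `⟨l_j|φ⟩ = 0`; see the three facts below. -/
def horizontalLift (φ : (Fin m → ℝ) → H) (θ : Fin m → ℝ) (j : Fin m) : H :=
  (2 : ℂ) • (fderiv ℝ φ θ (Pi.single j 1) -
    (inner ℂ (φ θ) (fderiv ℝ φ θ (Pi.single j 1)) : ℂ) • φ θ)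

theorem inner_horizontalLift (φ : (Fin m → ℝ) → H) (θ : Fin m → ℝ) (j : Fin m)
    (h1 : ‖φ θ‖ = 1) : inner ℂ (horizontalLift φ θ j) (φ θ) = 0 := by
  rw [← inner_conj_symm]
  simp [horizontalLift, inner_sub_right, inner_smul_right, inner_self_eq_norm_sq_to_K, h1]

theorem isBoundedBilinearMap_rankOne :
    IsBoundedBilinearMap ℝ (fun p : H × H => InnerProductSpace.rankOne ℂ p.1 p.2) where
  add_left x y z := by simp
  smul_left c x y := by
    ext z
    simp [← Complex.coe_smul, smul_smul]
  add_right x y z := by simp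
  smul_right c x y := by
    ext z
    simp [← Complex.coe_smul]
  bound := ⟨1, one_pos, fun x y => by simp⟩

theorem hasDerivAt_rankOne (φ : (Fin m → ℝ) → H) (θ : Fin m → ℝ) (j : Fin m)
    (hd : DifferentiableAt ℝ φ θ) (h1 : ∀ᶠ η in 𝓝 θ, ‖φ η‖ = 1) :
    HasDerivAt (fun t : ℝ => InnerProductSpace.rankOne ℂ (φ (θ + t • Pi.single j 1))
        (φ (θ + t • Pi.single j 1)))
      ((1 / 2 : ℂ) • (InnerProductSpace.rankOne ℂ (horizontalLift φ θ j) (φ θ) +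
        InnerProductSpace.rankOne ℂ (φ θ) (horizontalLift φ θ j))) 0 := by
  set d : H := fderiv ℝ φ θ (Pi.single j 1) with hdd
  have hline : HasDerivAt (fun t : ℝ => θ + t • (Pi.single j 1 : Fin m → ℝ)) (Pi.single j 1) 0 := by
    simpa using ((hasDerivAt_id (0 : ℝ)).smul_const (Pi.single j 1 : Fin m → ℝ)).const_add θ
  have h0 : θ + (0 : ℝ) • (Pi.single j 1 : Fin m → ℝ) = θ := by simp
  have hφ : HasDerivAt (fun t : ℝ => φ (θ + t • Pi.single j 1)) d 0 := by
    have hd' : HasFDerivAt φ (fderiv ℝ φ θ) (θ + (0 : ℝ) • (Pi.single j 1 : Fin m → ℝ)) := by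
      rw [h0]; exact hd.hasFDerivAt
    exact hd'.comp_hasDerivAt (0 : ℝ) hline
  have hre : (inner ℂ (φ θ) d).re = 0 := by
    let : InnerProductSpace ℝ H := InnerProductSpace.complexToReal
    have ha := hφ.norm_sq
    have hb : HasDerivAt (fun t : ℝ => ‖φ (θ + t • Pi.single j 1)‖ ^ 2) 0 0 := by
      refine (hasDerivAt_const (0 : ℝ) (1 : ℝ)).congr_of_eventuallyEq ?_
      have ht : Tendsto (fun t : ℝ => θ + t • (Pi.single j 1 : Fin m → ℝ)) (𝓝 0) (𝓝 θ) := by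
        simpa using hline.continuousAt.tendsto
      filter_upwards [ht.eventually h1] with t ht
      simp [ht]
    have hc := ha.unique hb
    rw [h0] at hc
    rw [real_inner_eq_re_inner ℂ] at hc
    simpa using hc
  have hB := (isBoundedBilinearMap_rankOne (H := H)).hasFDerivAt
    (φ (θ + (0 : ℝ) • Pi.single j 1), φ (θ + (0 : ℝ) • Pi.single j 1))
  have hC := hB.comp_hasDerivAt (0 : ℝ) (hφ.prodMk hφ)
  refine hC.congr_deriv ?_
  rw [h0]
  ext z
  have hconj : inner ℂ d (φ θ) = -(inner ℂ (φ θ) d : ℂ) := by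
    rw [← inner_conj_symm d (φ θ)]
    apply Complex.ext
    · rw [Complex.conj_re, Complex.neg_re, hre, neg_zero]
    · rw [Complex.conj_im, Complex.neg_im]
  have hl : horizontalLift φ θ j = (2 : ℂ) • (d - (inner ℂ (φ θ) d : ℂ) • φ θ) := rfl
  rw [hl]
  simp only [IsBoundedBilinearMap.deriv_apply, add_apply,
    smul_apply, InnerProductSpace.rankOne_apply, inner_smul_left,
    inner_sub_left, inner_conj_symm, hconj, map_ofNat]
  module

theorem horizontalLift_unique (φ : (Fin m → ℝ) → H) (θ : Fin m → ℝ) (j : Fin m)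
    (hd : DifferentiableAt ℝ φ θ) (h1 : ∀ᶠ η in 𝓝 θ, ‖φ η‖ = 1) (l : H)
    (hl : HasDerivAt (fun t : ℝ => InnerProductSpace.rankOne ℂ (φ (θ + t • Pi.single j 1))
        (φ (θ + t • Pi.single j 1)))
      ((1 / 2 : ℂ) • (InnerProductSpace.rankOne ℂ l (φ θ) +
        InnerProductSpace.rankOne ℂ (φ θ) l)) 0)
    (hl0 : inner ℂ l (φ θ) = 0) : l = horizontalLift φ θ j := by
  have h := congrArg (fun A : H →L[ℂ] H => A (φ θ))
    (hl.unique (hasDerivAt_rankOne φ θ j hd h1))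
  have hn : ‖φ θ‖ = 1 := h1.self_of_nhds
  simpa [hl0, inner_horizontalLift φ θ j hn, inner_self_eq_norm_sq_to_K, hn] using h

/-- `φ'` and `l'` reproduce the Gram matrix of the unit vector `φ` and of the vectors `l j ⟂ φ`. -/
def IsCopy {K : Type*} [NormedAddCommGroup K] [InnerProductSpace ℂ K]
    (l : Fin m → H) (φ' : K) (l' : Fin m → K) : Prop :=
  inner ℂ φ' φ' = (1 : ℂ) ∧ (∀ j, inner ℂ φ' (l' j) = (0 : ℂ)) ∧
    ∀ i j, inner ℂ (l' i) (l' j) = (inner ℂ (l i) (l j) : ℂ)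

/-- The set `𝒱` of the covariance matrices of all locally unbiased measurements. -/
def covRegion (θ : Fin m → ℝ) (ψ : H) (l : Fin m → H) : Set (Matrix (Fin m) (Fin m) ℝ) :=
  {V | ∃ M : POVM (Fin m → ℝ) H, M.IsLocallyUnbiased θ ψ l ∧ M.cov θ ψ = V}

/-- The covariance matrices of the measurements with locally bounded second moments whose
expectation is locally unbiased at `θ`. -/
def covRegionInMean (φ : (Fin m → ℝ) → H) (θ : Fin m → ℝ) : Set (Matrix (Fin m) (Fin m) ℝ) :=
  {V | ∃ M : POVM (Fin m → ℝ) H, M.HasLocallyBoundedSecondMoments φ θ ∧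
    M.IsLocallyUnbiasedInMean φ θ ∧ M.cov θ (φ θ) = V}

/-- The matrices `Re X*X`, where `X` runs over the systems of vectors orthogonal to `ψ` with
`Im X*X = 0` and `Re X*L = I`. -/
def vectorSystemRegion (ψ : H) (l : Fin m → H) : Set (Matrix (Fin m) (Fin m) ℝ) :=
  {V | ∃ x : Fin m → H, (∀ i, inner ℂ (x i) ψ = (0 : ℂ)) ∧
    (∀ i j, (inner ℂ (x i) (x j) : ℂ).im = 0) ∧
    (∀ i j, (inner ℂ (x i) (l j) : ℂ).re = if i = j then 1 else 0) ∧
    V = Matrix.of fun i j => (inner ℂ (x i) (x j) : ℂ).re}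

end

end QEst

namespace QEst

noncomputable section

/-! ### Laws, complex measures `⟨χ|M(·)ψ⟩` and their variation -/

namespace POVM

variable {Ω : Type*} [MeasurableSpace Ω] {H : Type u} [NormedAddCommGroup H]
  [InnerProductSpace ℂ H]

/-! Positivity of each `M(B)` bounds the variation of `⟨χ|M(·)ψ⟩` by the laws in the states `χ` and
`ψ`. This yields a Cauchy–Schwarz inequality for integrals against it that needs second moments in
the state `ψ` only. By Riesz, estimation vectors exist, and `V[M] - X*X` is positive semidefinite as
a complex Hermitian matrix (`posSemidef_cov_sub`). The same calculus gives part (0): the expectation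
in `ψ + δ` splits into a constant, a term linear in `δ`, and the integral against the law of `δ`,
which is `o(t)` along a differentiable curve with bounded second moments.

From measurements to vectors (`covRegion_subset`): write `V[M] - X*X = Z*Z`. The vectors `(xⁱ, zⁱ)`
in `H ⊕ ℂ^r` have the real Gram matrix `V[M]` and keep their inner products with the state and the
lifts. Together with these they number `(m+1) + m = 2m+1`, so they can be moved isometrically into
`K`, sending the state and the lifts to the given copy.

From vectors to measurements: if `X` has a real Gram matrix and is orthogonal to `φ'`, some
orthonormal basis `e` of `K` gives all these vectors real coordinates, those of `φ'` being equal and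
nonzero. Measuring in `e`, with outcomes the coordinates of `X` divided by those of `φ'` and shifted
by `θ`, has estimation vectors `X` and covariance `Re X*X`; it is simple. A contraction `A : H → K`
realizing the copy pulls it back to `H`, the defect `1 - A†A` being assigned the harmless outcome
`θ`. -/

theorem re_inner_op_nonneg (M : POVM Ω H) (ψ : H) {B : Set Ω} (hB : MeasurableSet B) :
    0 ≤ (inner ℂ ψ (M.op B ψ)).re :=
  (M.isPositive B hB).re_inner_nonneg_right ψ

theorem law_real (M : POVM Ω H) (ψ : H) {B : Set Ω} (hB : MeasurableSet B) :
    (M.law ψ).real B = (inner ℂ ψ (M.op B ψ)).re := by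
  rw [measureReal_def, law_apply _ _ hB,
    ENNReal.toReal_ofReal (M.re_inner_op_nonneg ψ hB)]

instance (M : POVM Ω H) (ψ : H) : IsFiniteMeasure (M.law ψ) :=
  ⟨by rw [law_apply _ _ MeasurableSet.univ]; exact ENNReal.ofReal_lt_top⟩

theorem law_real_univ (M : POVM Ω H) (ψ : H) : (M.law ψ).real Set.univ = ‖ψ‖ ^ 2 := by
  rw [law_real _ _ MeasurableSet.univ, M.op_univ]
  simp [inner_self_eq_norm_sq_to_K, ← Complex.ofReal_pow]

theorem inner_op_comm (M : POVM Ω H) (χ ψ : H) {B : Set Ω} (hB : MeasurableSet B) :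
    inner ℂ χ (M.op B ψ) = starRingEnd ℂ (inner ℂ ψ (M.op B χ)) := by
  rw [inner_conj_symm]
  exact ((M.isPositive B hB).isSymmetric χ ψ).symm

/-- Positivity of `M(B)` at `tχ - uψ`, where the phase `u` makes the cross term real and
nonnegative. The free `t` allows the two laws to be weighted differently on each level set of an
integrand. -/
theorem two_mul_norm_inner_op_le (M : POVM Ω H) (χ ψ : H) {B : Set Ω} (hB : MeasurableSet B)
    (t : ℝ) : 2 * t * ‖inner ℂ χ (M.op B ψ)‖ ≤
      t ^ 2 * (inner ℂ χ (M.op B χ)).re + (inner ℂ ψ (M.op B ψ)).re := by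
  obtain ⟨u, hu, hc⟩ : ∃ u : ℂ, ‖u‖ = 1 ∧ u * inner ℂ χ (M.op B ψ) = ‖inner ℂ χ (M.op B ψ)‖ := by
    obtain ⟨u, hu, h⟩ := RCLike.exists_norm_eq_mul_self (inner ℂ χ (M.op B ψ))
    exact ⟨u, hu, h.symm⟩
  have h := (M.isPositive B hB).re_inner_nonneg_right ((t : ℂ) • χ - u • ψ)
  have huu : starRingEnd ℂ u * u = 1 := by
    rw [Complex.conj_mul', hu]; simp
  have hexp : inner ℂ ((t : ℂ) • χ - u • ψ) (M.op B ((t : ℂ) • χ - u • ψ)) =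
      (t : ℂ) ^ 2 * inner ℂ χ (M.op B χ) + inner ℂ ψ (M.op B ψ)
        - t * ((‖inner ℂ χ (M.op B ψ)‖ : ℂ) + starRingEnd ℂ (‖inner ℂ χ (M.op B ψ)‖ : ℂ)) := by
    rw [← hc]
    simp only [map_sub, map_smul, inner_sub_left, inner_sub_right, inner_smul_left,
      inner_smul_right, Complex.conj_ofReal, map_mul, ← inner_op_comm M ψ χ hB]
    linear_combination (inner ℂ ψ (M.op B ψ)) * huu
  rw [hexp] at h
  simp [← Complex.ofReal_pow] at h
  linarith

/-- The total variation of `B ↦ ⟨χ| M(B) ψ⟩` is controlled by the laws in the states `χ`, `ψ`. -/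
theorem variation_complexMeasure_le (M : POVM Ω H) (χ ψ : H) {t : ℝ} (ht : 0 < t) :
    (M.complexMeasure χ ψ).variation ≤
      ENNReal.ofReal (t / 2) • M.law χ + ENNReal.ofReal (t⁻¹ / 2) • M.law ψ := by
  refine VectorMeasure.variation_le_of_forall_enorm_le fun B hB => ?_
  have ha := M.re_inner_op_nonneg χ hB
  have hb := M.re_inner_op_nonneg ψ hB
  simp only [Measure.add_apply, Measure.smul_apply, smul_eq_mul, law_apply _ _ hB,
    complexMeasure_apply _ _ _ hB]
  rw [← ENNReal.ofReal_mul (by positivity), ← ENNReal.ofReal_mul (by positivity),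
    ← ENNReal.ofReal_add (mul_nonneg (by positivity) ha) (mul_nonneg (by positivity) hb),
    ← ofReal_norm]
  refine ENNReal.ofReal_le_ofReal ?_
  have h := two_mul_norm_inner_op_le M χ ψ hB t
  have : t / 2 * (inner ℂ χ (M.op B χ)).re + t⁻¹ / 2 * (inner ℂ ψ (M.op B ψ)).re =
    (t ^ 2 * (inner ℂ χ (M.op B χ)).re + (inner ℂ ψ (M.op B ψ)).re) / (2 * t) := by
    field_simp
  rw [this, le_div_iff₀ (by positivity)]
  linarith

instance (M : POVM Ω H) (χ ψ : H) : IsFiniteMeasure (M.complexMeasure χ ψ).variation := by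
  have := M.variation_complexMeasure_le χ ψ one_pos
  have h1 := (M.law χ).smul_finite (ENNReal.ofReal_ne_top (r := 1 / 2))
  have h2 := (M.law ψ).smul_finite (ENNReal.ofReal_ne_top (r := 1⁻¹ / 2))
  exact isFiniteMeasure_of_le _ this

end POVM

/-! ### Integration against dominated vector measures -/

/-- If `ν ≤ (t α + t⁻¹ β) / 2` for all `t > 0`, then `∫ f dν ≤ (α(Ω) + ∫ f² dβ) / 2`. -/
theorem lintegral_le_of_forall_le {Ω : Type*} [MeasurableSpace Ω] {α β ν : Measure Ω}
    (h : ∀ t : ℝ, 0 < t → ν ≤ ENNReal.ofReal (t / 2) • α + ENNReal.ofReal (t⁻¹ / 2) • β)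
    {f : Ω → ENNReal} (hf : Measurable f) :
    2 * ∫⁻ ω, f ω ∂ν ≤ α Set.univ + ∫⁻ ω, f ω ^ 2 ∂β := by
  rw [lintegral_eq_iSup_eapprox_lintegral hf, ENNReal.mul_iSup]
  refine iSup_le fun n => ?_
  set g := SimpleFunc.eapprox f n
  have hg : ∀ ω, g ω ≤ f ω := fun ω => by
    rw [← SimpleFunc.iSup_eapprox_apply hf ω]
    exact le_iSup (fun k => SimpleFunc.eapprox f k ω) n
  have hlt : ∀ x ∈ g.range, x ≠ ⊤ := by
    intro x hx
    obtain ⟨ω, rfl⟩ := SimpleFunc.mem_range.1 hx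
    exact (SimpleFunc.eapprox_lt_top f n ω).ne
  have hone : α Set.univ = (g.map (fun _ => (1 : ENNReal))).lintegral α := by
    rw [← SimpleFunc.lintegral_eq_lintegral]; simp
  have hsq : (g.map (fun x => x ^ 2)).lintegral β ≤ ∫⁻ ω, f ω ^ 2 ∂β := by
    rw [← SimpleFunc.lintegral_eq_lintegral]
    refine lintegral_mono fun ω => ?_
    simp only [SimpleFunc.map_apply]
    gcongr
    exact hg ω
  refine le_trans ?_ (add_le_add_right hsq _)
  rw [hone, SimpleFunc.map_lintegral, SimpleFunc.map_lintegral, SimpleFunc.lintegral,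
    Finset.mul_sum, ← Finset.sum_add_distrib]
  refine Finset.sum_le_sum fun x hx => ?_
  rcases eq_or_ne x 0 with rfl | hx0
  · simp
  lift x to NNReal using hlt x hx
  have hxp : (0 : ℝ) < x := by
    have : x ≠ 0 := by exact_mod_cast hx0
    positivity
  -- On the level set of value `x` the choice `t = 1/x` turns the bound on `2xν` into `α + x²β`.
  have hle := h (x : ℝ)⁻¹ (by positivity) (g ⁻¹' {(x : ENNReal)})
  simp only [Measure.add_apply, Measure.smul_apply, smul_eq_mul, inv_inv] at hle
  calc 2 * ((x : ENNReal) * ν (g ⁻¹' {(x : ENNReal)}))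
      ≤ 2 * ((x : ENNReal) * (ENNReal.ofReal ((x : ℝ)⁻¹ / 2) * α (g ⁻¹' {(x : ENNReal)}) +
        ENNReal.ofReal ((x : ℝ) / 2) * β (g ⁻¹' {(x : ENNReal)}))) := by gcongr
    _ = 1 * α (g ⁻¹' {(x : ENNReal)}) + (x : ENNReal) ^ 2 * β (g ⁻¹' {(x : ENNReal)}) := by
      have h1 : 2 * ((x : ENNReal) * ENNReal.ofReal ((x : ℝ)⁻¹ / 2)) = 1 := by
        rw [← ENNReal.ofReal_coe_nnreal, ← ENNReal.ofReal_ofNat 2,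
          ← ENNReal.ofReal_mul (by positivity), ← ENNReal.ofReal_mul (by positivity),
          ← ENNReal.ofReal_one]
        congr 1
        field_simp
      have h2 : 2 * ((x : ENNReal) * ENNReal.ofReal ((x : ℝ) / 2)) = (x : ENNReal) ^ 2 := by
        rw [← ENNReal.ofReal_coe_nnreal, ← ENNReal.ofReal_ofNat 2,
          ← ENNReal.ofReal_mul (by positivity), ← ENNReal.ofReal_mul (by positivity),
          ← ENNReal.ofReal_pow (by positivity)]
        congr 1
        field_simp
      rw [mul_add, mul_add, ← mul_assoc, ← mul_assoc, ← mul_assoc, ← mul_assoc, mul_assoc 2, h1,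
        mul_assoc 2, h2]
-- Domination makes the integral a continuous function on `L¹(α)`, so integrals against two measures
-- dominated by the same `α` can be compared on a dense set.
theorem continuous_integral_of_variation_le {Ω E F G : Type*} [MeasurableSpace Ω]
    [NormedAddCommGroup E] [NormedSpace ℝ E] [NormedAddCommGroup F] [NormedSpace ℝ F]
    [NormedAddCommGroup G] [NormedSpace ℝ G] {μ : VectorMeasure Ω F} (B : E →L[ℝ] F →L[ℝ] G)
    {α : Measure Ω} (h : μ.variation ≤ α) :
    Continuous fun f : Ω →₁[α] E => VectorMeasure.integral μ f B := by
  have h1 : μ.variation ≤ (1 : ENNReal) • α := by rwa [one_smul]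
  have hc := (VectorMeasure.continuous_integral (μ := μ) (B := B)).comp
    (continuous_L1_toL1 (G := E) 1 ENNReal.one_ne_top h1)
  refine hc.congr fun f => ?_
  exact VectorMeasure.integral_congr_ae (Integrable.coeFn_toL1 _)

/-- The integral depends on the pairing and the vector measure only through their composition. -/
theorem integral_eq_of_forall_eq {Ω E F F' G : Type*} [MeasurableSpace Ω]
    [NormedAddCommGroup E] [NormedSpace ℝ E] [NormedAddCommGroup F] [NormedSpace ℝ F]
    [NormedAddCommGroup F'] [NormedSpace ℝ F'] [NormedAddCommGroup G] [NormedSpace ℝ G]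
    [CompleteSpace G]
    {μ : VectorMeasure Ω F} {ν : VectorMeasure Ω F'} {B : E →L[ℝ] F →L[ℝ] G}
    {C : E →L[ℝ] F' →L[ℝ] G} (h : ∀ s, MeasurableSet s → ∀ e, B e (μ s) = C e (ν s)) {f : Ω → E}
    (hμ : μ.Integrable f) (hν : ν.Integrable f) :
    VectorMeasure.integral μ f B = VectorMeasure.integral ν f C := by
  have hμle : μ.variation ≤ μ.variation + ν.variation := Measure.le_add_right le_rfl
  have hνle : ν.variation ≤ μ.variation + ν.variation := Measure.le_add_left le_rfl
  -- The induction runs in `L¹` of the sum of the two variations, which dominates both.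
  refine (hμ.add_measure hν).induction
    (P := fun f => VectorMeasure.integral μ f B = VectorMeasure.integral ν f C) ?_ ?_ ?_ ?_
  · intro e s hs hfin
    have i1 : IsFiniteMeasure (μ.variation.restrict s) := ⟨by simpa using (hμle s).trans_lt hfin⟩
    have i2 : IsFiniteMeasure (ν.variation.restrict s) := ⟨by simpa using (hνle s).trans_lt hfin⟩
    rw [VectorMeasure.integral_indicator_const e hs, VectorMeasure.integral_indicator_const e hs,
      h s hs]
  · intro f g _ hf hg hfe hge
    rw [VectorMeasure.integral_add (hf.mono_measure hμle) (hg.mono_measure hμle),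
      VectorMeasure.integral_add (hf.mono_measure hνle) (hg.mono_measure hνle), hfe, hge]
  · exact isClosed_eq (continuous_integral_of_variation_le B hμle)
      (continuous_integral_of_variation_le C hνle)
  · intro f g hfg _ hf
    rwa [VectorMeasure.integral_congr_ae (hfg.filter_mono (ae_mono hμle)),
      VectorMeasure.integral_congr_ae (hfg.filter_mono (ae_mono hνle))] at hf

/-- Images of vector measures under continuous linear maps commute with integrals. -/
theorem integral_eq_map_integral {Ω F F' : Type*} [MeasurableSpace Ω] [NormedAddCommGroup F]
    [NormedSpace ℝ F] [CompleteSpace F] [NormedAddCommGroup F'] [NormedSpace ℝ F']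
    [CompleteSpace F'] {μ : VectorMeasure Ω F} {ν : VectorMeasure Ω F'} (L : F →L[ℝ] F')
    (h : ∀ B, MeasurableSet B → ν B = L (μ B)) {f : Ω → ℝ}
    (hμ : μ.Integrable f) (hν : ν.Integrable f) :
    VectorMeasure.integral ν f (ContinuousLinearMap.lsmul ℝ ℝ) =
      L (VectorMeasure.integral μ f (ContinuousLinearMap.lsmul ℝ ℝ)) := by
  rw [VectorMeasure.continuousLinearMap_apply_integral hμ]
  refine integral_eq_of_forall_eq (fun B hB r => ?_) hν hμ
  simp [h B hB]

/-! ### Cauchy–Schwarz for integrals against `⟨χ|M(dω)ψ⟩` -/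

namespace POVM

variable {Ω : Type*} [MeasurableSpace Ω] {H : Type u} [NormedAddCommGroup H]
  [InnerProductSpace ℂ H]

theorem integral_law_eq (M : POVM Ω H) (ψ : H) {f : Ω → ℝ} (hf : Integrable f (M.law ψ)) :
    VectorMeasure.integral (M.complexMeasure ψ ψ) f (ContinuousLinearMap.lsmul ℝ ℝ) =
      ((∫ ω, f ω ∂(M.law ψ) : ℝ) : ℂ) := by
  -- For `χ = ψ` and `t = 1` the two halves of the variation bound add up to the law.
  have hle : (M.complexMeasure ψ ψ).variation ≤ M.law ψ := by
    refine (M.variation_complexMeasure_le ψ ψ one_pos).trans (le_of_eq ?_)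
    rw [← add_smul, ← ENNReal.ofReal_add (by norm_num) (by norm_num)]
    norm_num
  have hs : (M.law ψ).toSignedMeasure.Integrable f := by
    rw [VectorMeasure.Integrable, Measure.variation_toSignedMeasure]
    exact hf
  have hr : VectorMeasure.integral (M.law ψ).toSignedMeasure f (ContinuousLinearMap.lsmul ℝ ℝ) =
      ∫ ω, f ω ∂(M.law ψ) := by
    rw [← VectorMeasure.integral_toSignedMeasure]
    exact integral_eq_of_forall_eq (fun B hB r => by simp [mul_comm]) hs hs
  rw [← hr, ← Complex.ofRealCLM_apply]
  refine integral_eq_map_integral Complex.ofRealCLM (fun B hB => ?_) hs (hf.mono_measure hle)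
  rw [complexMeasure_apply _ _ _ hB, Complex.ofRealCLM_apply,
    Measure.toSignedMeasure_apply_measurable hB, law_real _ _ hB]
  exact ((M.isPositive B hB).isSymmetric.coe_re_inner_self_apply ψ).symm

theorem lintegral_variation_le {E : Type*} [NormedAddCommGroup E] [MeasurableSpace E]
    [OpensMeasurableSpace E]
    (M : POVM Ω H) (χ ψ : H) {f : Ω → E} (hf : Measurable f) :
    2 * ∫⁻ ω, ‖f ω‖ₑ ∂(M.complexMeasure χ ψ).variation ≤
      M.law χ Set.univ + ∫⁻ ω, ‖f ω‖ₑ ^ 2 ∂(M.law ψ) :=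
  lintegral_le_of_forall_le (fun _ ht => M.variation_complexMeasure_le χ ψ ht) hf.enorm

/-- The law of `χ` enters the domination only through its finite total mass, so no moment in the
state `χ` is required and every test vector is allowed. -/
theorem integrable_variation {E : Type*} [NormedAddCommGroup E] [MeasurableSpace E]
    [BorelSpace E] [SecondCountableTopology E]
    (M : POVM Ω H) (χ ψ : H) {f : Ω → E} (hf : Measurable f)
    (hf2 : Integrable (fun ω => ‖f ω‖ ^ 2) (M.law ψ)) :
    Integrable f (M.complexMeasure χ ψ).variation := by
  refine ⟨hf.aestronglyMeasurable, ?_⟩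
  have h := M.lintegral_variation_le χ ψ hf
  have h2 := hf2.2
  simp only [HasFiniteIntegral, enorm_pow, enorm_norm] at h2 ⊢
  have h3 := lt_of_le_of_lt h (ENNReal.add_lt_top.2 ⟨measure_lt_top _ _, h2⟩)
  by_contra hcon
  rw [not_lt, top_le_iff] at hcon
  simp [hcon] at h3

theorem two_mul_integral_variation_le {E : Type*} [NormedAddCommGroup E] [MeasurableSpace E]
    [BorelSpace E] [SecondCountableTopology E]
    (M : POVM Ω H) (χ ψ : H) {f : Ω → E} (hf : Measurable f)
    (hf2 : Integrable (fun ω => ‖f ω‖ ^ 2) (M.law ψ)) :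
    2 * ∫ ω, ‖f ω‖ ∂(M.complexMeasure χ ψ).variation ≤ ‖χ‖ ^ 2 + ∫ ω, ‖f ω‖ ^ 2 ∂(M.law ψ) := by
  have hi := M.integrable_variation χ ψ hf hf2
  have h := M.lintegral_variation_le χ ψ hf
  have e1 : ∫⁻ ω, ‖f ω‖ₑ ∂(M.complexMeasure χ ψ).variation =
      ENNReal.ofReal (∫ ω, ‖f ω‖ ∂(M.complexMeasure χ ψ).variation) :=
    (ofReal_integral_norm_eq_lintegral_enorm hi).symm
  have e2 : ∫⁻ ω, ‖f ω‖ₑ ^ 2 ∂(M.law ψ) = ENNReal.ofReal (∫ ω, ‖f ω‖ ^ 2 ∂(M.law ψ)) := by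
    rw [ofReal_integral_eq_lintegral_ofReal hf2 (Eventually.of_forall fun ω => by positivity)]
    refine lintegral_congr fun ω => ?_
    rw [ENNReal.ofReal_pow (norm_nonneg _), ofReal_norm]
  have e3 : M.law χ Set.univ = ENNReal.ofReal (‖χ‖ ^ 2) := by
    rw [← M.law_real_univ, ofReal_measureReal]
  rw [e1, e2, e3, ← ENNReal.ofReal_ofNat 2, ← ENNReal.ofReal_mul (by norm_num),
    ← ENNReal.ofReal_add (by positivity) (by positivity)] at h
  exact (ENNReal.ofReal_le_ofReal_iff (by positivity)).1 h

/-- The Cauchy–Schwarz inequality for integrals against `⟨χ| M(dω) ψ⟩`. -/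
theorem sq_integral_variation_le {E : Type*} [NormedAddCommGroup E] [NormedSpace ℝ E]
    [MeasurableSpace E] [BorelSpace E] [SecondCountableTopology E]
    (M : POVM Ω H) (χ ψ : H) {f : Ω → E} (hf : Measurable f)
    (hf2 : Integrable (fun ω => ‖f ω‖ ^ 2) (M.law ψ)) :
    (∫ ω, ‖f ω‖ ∂(M.complexMeasure χ ψ).variation) ^ 2 ≤
      ‖χ‖ ^ 2 * ∫ ω, ‖f ω‖ ^ 2 ∂(M.law ψ) := by
  set I := ∫ ω, ‖f ω‖ ∂(M.complexMeasure χ ψ).variation with hI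
  set S := ∫ ω, ‖f ω‖ ^ 2 ∂(M.law ψ) with hS
  -- Replacing `f` by `t f` gives a quadratic in `t` that is nowhere negative; its discriminant is
  -- the claim.
  have key : ∀ t : ℝ, 0 ≤ S * (t * t) + (-2 * I) * t + ‖χ‖ ^ 2 := by
    intro t
    have hI0 : 0 ≤ I := by positivity
    have hn : ∀ ω, ‖(t • f) ω‖ = |t| * ‖f ω‖ := fun ω => by
      rw [Pi.smul_apply, norm_smul, Real.norm_eq_abs]
    have h := M.two_mul_integral_variation_le χ ψ (hf.const_smul t) (by
      simp only [hn, mul_pow]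
      exact hf2.const_mul _)
    simp only [hn, mul_pow, integral_const_mul, sq_abs] at h
    rw [← hI, ← hS] at h
    nlinarith [mul_le_mul_of_nonneg_right (le_abs_self t) hI0]
  have := discrim_le_zero key
  rw [discrim] at this
  nlinarith

end POVM

/-! ### Weak integrals and the laws of sums of vectors -/

namespace POVM

variable {Ω : Type*} [MeasurableSpace Ω] {H : Type u} [NormedAddCommGroup H]
  [InnerProductSpace ℂ H]

/-- The integral `∫ f(ω) ⟨χ| M(dω) ψ⟩`. -/
def weakIntegral (M : POVM Ω H) (χ ψ : H) (f : Ω → ℝ) : ℂ :=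
  VectorMeasure.integral (M.complexMeasure χ ψ) f (ContinuousLinearMap.lsmul ℝ ℝ)

theorem integrable_complexMeasure (M : POVM Ω H) (χ ψ : H) {f : Ω → ℝ} (hf : Measurable f)
    (hf2 : Integrable (fun ω => f ω ^ 2) (M.law ψ)) : (M.complexMeasure χ ψ).Integrable f :=
  M.integrable_variation χ ψ hf (by simpa using hf2)

/-- `L` is only real linear, so that complex conjugation, hence Hermitian symmetry, is covered along
with scalar multiplication. -/
theorem weakIntegral_eq_map (M : POVM Ω H) (L : ℂ →L[ℝ] ℂ) {χ ψ χ' ψ' : H}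
    (h : ∀ B, MeasurableSet B → inner ℂ χ' (M.op B ψ') = L (inner ℂ χ (M.op B ψ))) {f : Ω → ℝ}
    (hf : Measurable f) (hf2 : Integrable (fun ω => f ω ^ 2) (M.law ψ))
    (hf2' : Integrable (fun ω => f ω ^ 2) (M.law ψ')) :
    M.weakIntegral χ' ψ' f = L (M.weakIntegral χ ψ f) := by
  refine integral_eq_map_integral L (fun B hB => ?_) (M.integrable_complexMeasure χ ψ hf hf2)
    (M.integrable_complexMeasure χ' ψ' hf hf2')
  rw [complexMeasure_apply _ _ _ hB, complexMeasure_apply _ _ _ hB, h B hB]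

theorem weakIntegral_smul_left (M : POVM Ω H) (z : ℂ) (χ ψ : H) {f : Ω → ℝ}
    (hf : Measurable f) (hf2 : Integrable (fun ω => f ω ^ 2) (M.law ψ)) :
    M.weakIntegral (z • χ) ψ f = starRingEnd ℂ z * M.weakIntegral χ ψ f :=
  M.weakIntegral_eq_map (ContinuousLinearMap.mul ℝ ℂ (starRingEnd ℂ z))
    (fun B _ => by simp [mul_comm]) hf hf2 hf2

theorem weakIntegral_comm (M : POVM Ω H) (χ ψ : H) {f : Ω → ℝ}
    (hf : Measurable f) (hf2 : Integrable (fun ω => f ω ^ 2) (M.law ψ))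
    (hf2' : Integrable (fun ω => f ω ^ 2) (M.law χ)) :
    M.weakIntegral ψ χ f = starRingEnd ℂ (M.weakIntegral χ ψ f) :=
  M.weakIntegral_eq_map (Complex.conjCLE : ℂ →L[ℝ] ℂ)
    (fun B hB => by simpa using M.inner_op_comm ψ χ hB) hf hf2 hf2'

theorem weakIntegral_add_left (M : POVM Ω H) (χ χ' ψ : H) {f : Ω → ℝ}
    (hf : Measurable f) (hf2 : Integrable (fun ω => f ω ^ 2) (M.law ψ)) :
    M.weakIntegral (χ + χ') ψ f = M.weakIntegral χ ψ f + M.weakIntegral χ' ψ f := by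
  have : M.complexMeasure (χ + χ') ψ = M.complexMeasure χ ψ + M.complexMeasure χ' ψ := by
    ext B hB
    simp [complexMeasure_apply _ _ _ hB]
  rw [weakIntegral, this, VectorMeasure.integral_add_vectorMeasure
    (M.integrable_complexMeasure χ ψ hf hf2) (M.integrable_complexMeasure χ' ψ hf hf2)]
  rfl

theorem weakIntegral_self (M : POVM Ω H) (ψ : H) {f : Ω → ℝ} (hf : Integrable f (M.law ψ)) :
    M.weakIntegral ψ ψ f = ((∫ ω, f ω ∂(M.law ψ) : ℝ) : ℂ) :=
  M.integral_law_eq ψ hf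

theorem integrable_of_sq {α : Measure Ω} [IsFiniteMeasure α] {f : Ω → ℝ}
    (hf : Measurable f) (hf2 : Integrable (fun ω => f ω ^ 2) α) : Integrable f α :=
  ((memLp_two_iff_integrable_sq hf.aestronglyMeasurable).2 hf2).integrable (by norm_num)

theorem sum_mul_weakIntegral {ι : Type*} [Fintype ι] (M : POVM Ω H) (χ ψ : H) {f : ι → Ω → ℝ}
    (hf : ∀ i, Measurable (f i)) (hf2 : ∀ i, Integrable (fun ω => f i ω ^ 2) (M.law ψ))
    (c : ι → ℂ) :
    ∑ i, c i * M.weakIntegral χ ψ (f i) =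
      VectorMeasure.integral (M.complexMeasure χ ψ) (fun ω => ∑ i, c i * (f i ω : ℂ))
        (ContinuousLinearMap.mul ℝ ℂ) := by
  have hi : ∀ i, (M.complexMeasure χ ψ).Integrable (f i) := fun i =>
    M.integrable_complexMeasure χ ψ (hf i) (hf2 i)
  rw [VectorMeasure.integral_finsetSum]
  · refine Finset.sum_congr rfl fun i _ => ?_
    let C : ℝ →L[ℝ] ℂ := (ContinuousLinearMap.mul ℝ ℂ (c i)).comp Complex.ofRealCLM
    have h1 := VectorMeasure.integral_continuousLinearMap_comp
      (B := ContinuousLinearMap.mul ℝ ℂ) (C := C) (hi i)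
    have h2 := VectorMeasure.continuousLinearMap_apply_integral
      (B := ContinuousLinearMap.lsmul ℝ ℝ) (C := ContinuousLinearMap.mul ℝ ℂ (c i)) (hi i)
    simp only [C, ContinuousLinearMap.comp_apply, ContinuousLinearMap.mul_apply',
      Complex.ofRealCLM_apply] at h1 h2
    rw [h1, weakIntegral, h2]
    refine integral_eq_of_forall_eq (fun B hB r => ?_) (hi i) (hi i)
    simp [mul_assoc]
  · intro i _
    exact (hi i).ofReal.const_mul (c i)

/-- The Cauchy–Schwarz inequality for complex combinations of weak integrals. -/
theorem sq_norm_sum_mul_weakIntegral_le {ι : Type*} [Fintype ι] (M : POVM Ω H) (χ ψ : H)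
    {f : ι → Ω → ℝ} (hf : ∀ i, Measurable (f i))
    (hf2 : ∀ i, Integrable (fun ω => f i ω ^ 2) (M.law ψ)) (c : ι → ℂ) :
    ‖∑ i, c i * M.weakIntegral χ ψ (f i)‖ ^ 2 ≤
      ‖χ‖ ^ 2 * ∫ ω, ‖∑ i, c i * (f i ω : ℂ)‖ ^ 2 ∂(M.law ψ) := by
  have hm : Measurable fun ω => ∑ i, c i * (f i ω : ℂ) := by fun_prop
  have hL : MemLp (fun ω => ∑ i, c i * (f i ω : ℂ)) 2 (M.law ψ) := by
    refine memLp_finsetSum _ fun i _ => ?_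
    exact (((memLp_two_iff_integrable_sq (hf i).aestronglyMeasurable).2 (hf2 i)).ofReal).const_mul _
  have h2 := (memLp_two_iff_integrable_sq_norm hm.aestronglyMeasurable).1 hL
  refine le_trans ?_ (M.sq_integral_variation_le χ ψ hm h2)
  rw [sum_mul_weakIntegral M χ ψ hf hf2]
  gcongr
  refine (VectorMeasure.norm_integral_le_integral_norm).trans ?_
  exact mul_le_of_le_one_left (by positivity) (ContinuousLinearMap.opNorm_mul_le ℝ ℂ)

theorem sq_norm_weakIntegral_le (M : POVM Ω H) (χ ψ : H) {f : Ω → ℝ} (hf : Measurable f)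
    (hf2 : Integrable (fun ω => f ω ^ 2) (M.law ψ)) :
    ‖M.weakIntegral χ ψ f‖ ^ 2 ≤ ‖χ‖ ^ 2 * ∫ ω, f ω ^ 2 ∂(M.law ψ) := by
  simpa using M.sq_norm_sum_mul_weakIntegral_le χ ψ (ι := Unit) (fun _ => hf) (fun _ => hf2)
    (fun _ => 1)

/-- Riesz representation: the weak integral is conjugate linear in `χ` and bounded by
Cauchy–Schwarz. This is the source of estimation vectors. -/
theorem exists_inner_eq_weakIntegral [CompleteSpace H] (M : POVM Ω H) (ψ : H) {f : Ω → ℝ}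
    (hf : Measurable f) (hf2 : Integrable (fun ω => f ω ^ 2) (M.law ψ)) :
    ∃ x : H, ∀ χ, inner ℂ χ x = M.weakIntegral χ ψ f := by
  let ℓ : H →ₗ[ℂ] ℂ :=
    { toFun := fun χ => starRingEnd ℂ (M.weakIntegral χ ψ f)
      map_add' := fun χ χ' => by rw [M.weakIntegral_add_left χ χ' ψ hf hf2, map_add]
      map_smul' := fun z χ => by rw [M.weakIntegral_smul_left z χ ψ hf hf2]; simp }
  let ℓc := ℓ.mkContinuous (Real.sqrt (∫ ω, f ω ^ 2 ∂(M.law ψ))) fun χ => by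
    have h0 : 0 ≤ ∫ ω, f ω ^ 2 ∂(M.law ψ) := integral_nonneg fun _ => sq_nonneg _
    refine abs_le_of_sq_le_sq' ?_ (by positivity) |>.2
    rw [mul_pow, Real.sq_sqrt h0, mul_comm]
    simpa [ℓ] using M.sq_norm_weakIntegral_le χ ψ hf hf2
  refine ⟨(InnerProductSpace.toDual ℂ H).symm ℓc, fun χ => ?_⟩
  rw [← inner_conj_symm, InnerProductSpace.toDual_symm_apply]
  simp [ℓc, ℓ]

/-- Parallelogram law for the quadratic form of `M(B)`, with the nonnegative value at `ψ - δ`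
dropped. It carries second moments over to increments of a curve. -/
theorem law_add_le (M : POVM Ω H) (ψ δ : H) :
    M.law (ψ + δ) ≤ (2 : ENNReal) • (M.law ψ + M.law δ) := by
  refine Measure.le_intro fun B hB _ => ?_
  have ha := M.re_inner_op_nonneg ψ hB
  have hb := M.re_inner_op_nonneg δ hB
  have hc := M.re_inner_op_nonneg (ψ - δ) hB
  simp only [Measure.smul_apply, Measure.add_apply, law_apply _ _ hB, smul_eq_mul]
  rw [← ENNReal.ofReal_add ha hb, ← ENNReal.ofReal_ofNat 2, ← ENNReal.ofReal_mul (by norm_num)]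
  refine ENNReal.ofReal_le_ofReal ?_
  simp only [map_add, map_sub, inner_add_left, inner_add_right, inner_sub_left, inner_sub_right,
    Complex.add_re, Complex.sub_re] at hc ⊢
  linarith

theorem integrable_law_add {f : Ω → ℝ} (M : POVM Ω H) {ψ δ : H} (hψ : Integrable f (M.law ψ))
    (hδ : Integrable f (M.law δ)) : Integrable f (M.law (ψ + δ)) :=
  (hψ.add_measure hδ).of_measure_le_smul (by norm_num) (M.law_add_le ψ δ)

theorem integral_law_add_le {f : Ω → ℝ} (M : POVM Ω H) {ψ δ : H} (hf : 0 ≤ f)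
    (hψ : Integrable f (M.law ψ)) (hδ : Integrable f (M.law δ)) :
    ∫ ω, f ω ∂(M.law (ψ + δ)) ≤ 2 * (∫ ω, f ω ∂(M.law ψ) + ∫ ω, f ω ∂(M.law δ)) := by
  have h := integral_mono_measure (M.law_add_le ψ δ) (Eventually.of_forall hf)
    ((hψ.add_measure hδ).smul_measure (by norm_num))
  rwa [integral_smul_measure, integral_add_measure hψ hδ] at h

theorem law_neg (M : POVM Ω H) (ψ : H) : M.law (-ψ) = M.law ψ := by
  refine Measure.ext fun B hB => ?_
  simp [law_apply _ _ hB]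

/-- Polarization: the cross terms are complex conjugates of each other. -/
theorem integral_law_add (M : POVM Ω H) {ψ δ : H} {f : Ω → ℝ} (hf : Measurable f)
    (hψ : Integrable (fun ω => f ω ^ 2) (M.law ψ)) (hδ : Integrable (fun ω => f ω ^ 2) (M.law δ)) :
    ∫ ω, f ω ∂(M.law (ψ + δ)) = ∫ ω, f ω ∂(M.law ψ) + ∫ ω, f ω ∂(M.law δ) +
      2 * (M.weakIntegral δ ψ f).re := by
  have hs := M.integrable_law_add hψ hδ
  have e : M.complexMeasure (ψ + δ) (ψ + δ) = M.complexMeasure ψ ψ + M.complexMeasure δ δ +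
      (M.complexMeasure δ ψ + M.complexMeasure ψ δ) := by
    ext B hB
    simp [complexMeasure_apply _ _ _ hB]
    ring
  have h := M.weakIntegral_self (ψ + δ) (integrable_of_sq hf hs)
  have i1 := M.integrable_complexMeasure ψ ψ hf hψ
  have i2 := M.integrable_complexMeasure δ δ hf hδ
  have i3 := M.integrable_complexMeasure δ ψ hf hψ
  have i4 := M.integrable_complexMeasure ψ δ hf hδ
  rw [weakIntegral, e, VectorMeasure.integral_add_vectorMeasure (i1.add_vectorMeasure i2)
    (i3.add_vectorMeasure i4), VectorMeasure.integral_add_vectorMeasure i1 i2,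
    VectorMeasure.integral_add_vectorMeasure i3 i4] at h
  change M.weakIntegral ψ ψ f + M.weakIntegral δ δ f +
    (M.weakIntegral δ ψ f + M.weakIntegral ψ δ f) = _ at h
  rw [M.weakIntegral_self ψ (integrable_of_sq hf hψ), M.weakIntegral_self δ (integrable_of_sq hf hδ),
    M.weakIntegral_comm δ ψ hf hψ hδ, Complex.add_conj] at h
  exact_mod_cast h.symm

end POVM

/-! ### Differentiating expectations along curves of vectors -/

namespace POVM

variable {Ω : Type*} [MeasurableSpace Ω] {H : Type u} [NormedAddCommGroup H]
  [InnerProductSpace ℂ H]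

theorem exists_law_real_lt (M : POVM Ω H) (d : H) {f : Ω → ℝ} (hf : Measurable f) {ε : ℝ}
    (hε : 0 < ε) : ∃ N : ℕ, (M.law d).real {ω | (N : ℝ) < |f ω|} < ε := by
  have hm : ∀ N : ℕ, MeasurableSet {ω | (N : ℝ) < |f ω|} := fun N =>
    measurableSet_lt measurable_const hf.abs
  have h := tendsto_measure_iInter_atTop (μ := M.law d) (s := fun N : ℕ => {ω | (N : ℝ) < |f ω|})
    (fun N => (hm N).nullMeasurableSet)
    (fun a b hab ω hω => lt_of_le_of_lt (by exact_mod_cast hab : (a : ℝ) ≤ b) hω)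
    ⟨0, measure_ne_top _ _⟩
  have hempty : ⋂ N : ℕ, {ω | (N : ℝ) < |f ω|} = ∅ := by
    refine Set.eq_empty_of_forall_notMem fun ω hω => ?_
    obtain ⟨N, hN⟩ := exists_nat_ge |f ω|
    exact absurd (Set.mem_iInter.1 hω N) (not_lt.2 hN)
  rw [hempty, measure_empty] at h
  have h' := (ENNReal.tendsto_toReal ENNReal.zero_ne_top).comp h
  exact (h'.eventually (gt_mem_nhds (by simpa using hε))).exists

/-- Truncation at `N`, with the arithmetic-geometric mean inequality on the tail. For `δ = O(t)` and
`s` proportional to `|t|`, the first term is `O(t²)` and the other two have small coefficients of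
`|t|`. -/
theorem abs_integral_law_le (M : POVM Ω H) (δ : H) {f : Ω → ℝ} (hf : Measurable f)
    (hf2 : Integrable (fun ω => f ω ^ 2) (M.law δ)) {s : ℝ} (hs : 0 < s) (N : ℕ) :
    |∫ ω, f ω ∂(M.law δ)| ≤ N * ‖δ‖ ^ 2 + s / 2 * ∫ ω, f ω ^ 2 ∂(M.law δ) +
      s⁻¹ / 2 * (M.law δ).real {ω | (N : ℝ) < |f ω|} := by
  set B := {ω | (N : ℝ) < |f ω|} with hB
  have hm : MeasurableSet B := measurableSet_lt measurable_const hf.abs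
  have i1 : Integrable (fun _ : Ω => (N : ℝ)) (M.law δ) := integrable_const _
  have i2 := hf2.const_mul (s / 2)
  have i3 : Integrable (B.indicator fun _ => s⁻¹ / 2) (M.law δ) :=
    (integrable_const _).indicator hm
  have i12 : Integrable (fun ω => (N : ℝ) + s / 2 * f ω ^ 2) (M.law δ) := i1.add i2
  have i123 : Integrable (fun ω => (N : ℝ) + s / 2 * f ω ^ 2 +
      B.indicator (fun _ => s⁻¹ / 2) ω) (M.law δ) := i12.add i3
  have hle : ∀ ω, |f ω| ≤ (N : ℝ) + s / 2 * f ω ^ 2 +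
      B.indicator (fun _ => s⁻¹ / 2) ω := by
    intro ω
    by_cases h : (N : ℝ) < |f ω|
    · rw [Set.indicator_of_mem (by exact h)]
      have h1 : s / 2 * f ω ^ 2 + s⁻¹ / 2 - |f ω| = (s * |f ω| - 1) ^ 2 / (2 * s) := by
        rw [← sq_abs (f ω)]
        field_simp
        ring
      have h2 : 0 ≤ (s * |f ω| - 1) ^ 2 / (2 * s) := by positivity
      have h3 : (0 : ℝ) ≤ N := by positivity
      linarith
    · rw [Set.indicator_of_notMem (by exact h)]
      have : 0 ≤ s / 2 * f ω ^ 2 := by positivity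
      linarith
  calc |∫ ω, f ω ∂(M.law δ)| ≤ ∫ ω, |f ω| ∂(M.law δ) := abs_integral_le_integral_abs
    _ ≤ ∫ ω, ((N : ℝ) + s / 2 * f ω ^ 2 +
        B.indicator (fun _ => s⁻¹ / 2) ω) ∂(M.law δ) :=
      integral_mono (integrable_of_sq hf hf2).abs i123 hle
    _ = N * ‖δ‖ ^ 2 + s / 2 * ∫ ω, f ω ^ 2 ∂(M.law δ) + s⁻¹ / 2 * (M.law δ).real B := by
      rw [integral_add i12 i3, integral_add i1 i2, integral_const, integral_const_mul,
        integral_indicator_const _ hm, law_real_univ, smul_eq_mul, smul_eq_mul]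
      ring

/-- The second order part of the expectation does not contribute to its derivative. -/
theorem hasDerivAt_integral_law_zero (M : POVM Ω H) {δ : ℝ → H} {d : H} (hδ : HasDerivAt δ d 0)
    (h0 : δ 0 = 0) {f : Ω → ℝ} (hf : Measurable f) {C : ℝ}
    (hb : ∀ᶠ t in 𝓝 0, Integrable (fun ω => f ω ^ 2) (M.law (δ t)) ∧
      ∫ ω, f ω ^ 2 ∂(M.law (δ t)) ≤ C) :
    HasDerivAt (fun t => ∫ ω, f ω ∂(M.law (δ t))) 0 0 := by
  have hlaw0 : M.law (0 : H) = 0 := by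
    refine Measure.ext fun B hB => ?_
    simp [law_apply _ _ hB]
  have hC : 0 ≤ C := (integral_nonneg fun _ => sq_nonneg _).trans hb.self_of_nhds.2
  rw [hasDerivAt_iff_tendsto_slope_zero]
  rw [hasDerivAt_iff_tendsto_slope_zero] at hδ
  simp only [zero_add, h0, sub_zero, hlaw0, integral_zero_measure] at hδ ⊢
  rw [Metric.tendsto_nhds]
  intro ε hε
  -- `σ` brings the second moment term below `ε/2`. Then `N` is chosen from the tail of the law of
  -- `d`, before `t`, so that the tail term is below `ε/2` in the limit.
  set σ := ε / (C + 1) with hσ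
  have hσ0 : 0 < σ := by positivity
  obtain ⟨N, hN⟩ := M.exists_law_real_lt d hf (ε := σ * ε) (by positivity)
  set B := {ω | (N : ℝ) < |f ω|} with hB
  have hm : MeasurableSet B := measurableSet_lt measurable_const hf.abs
  have hlim : Tendsto (fun t : ℝ => N * (|t| * ‖t⁻¹ • δ t‖ ^ 2) + σ / 2 * C +
      σ⁻¹ / 2 * (M.law (t⁻¹ • δ t)).real B) (𝓝[≠] 0)
      (𝓝 (N * (|0| * ‖d‖ ^ 2) + σ / 2 * C + σ⁻¹ / 2 * (M.law d).real B)) := by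
    have ht : Tendsto (fun t : ℝ => |t|) (𝓝[≠] 0) (𝓝 |0|) :=
      (continuous_abs.tendsto 0).mono_left nhdsWithin_le_nhds
    have hl : Tendsto (fun t : ℝ => (M.law (t⁻¹ • δ t)).real B) (𝓝[≠] 0)
        (𝓝 ((M.law d).real B)) := by
      simp only [law_real _ _ hm]
      have hc : Continuous fun v : H => (inner ℂ v (M.op B v)).re := by fun_prop
      exact (hc.tendsto d).comp hδ
    exact (((ht.mul (hδ.norm.pow 2)).const_mul _).add_const _).add (hl.const_mul _)
  have hlt : N * (|0| * ‖d‖ ^ 2) + σ / 2 * C + σ⁻¹ / 2 * (M.law d).real B < ε := by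
    have h1 : σ / 2 * C < ε / 2 := by
      have : σ * C < ε := by
        rw [hσ, div_mul_eq_mul_div, div_lt_iff₀ (by positivity)]
        nlinarith
      linarith
    have h2 : σ⁻¹ / 2 * (M.law d).real B < ε / 2 := by
      calc σ⁻¹ / 2 * (M.law d).real B < σ⁻¹ / 2 * (σ * ε) := by gcongr
        _ = ε / 2 := by field_simp
    simp only [abs_zero, zero_mul, mul_zero, zero_add]
    linarith
  filter_upwards [hlim.eventually (gt_mem_nhds hlt), hb.filter_mono nhdsWithin_le_nhds,
    self_mem_nhdsWithin] with t ht hbt ht0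
  have ht0' : t ≠ 0 := ht0
  have habs : 0 < |t| := abs_pos.2 ht0'
  refine lt_of_le_of_lt ?_ ht
  -- With `s = σ|t|`, division by `|t|` leaves exactly the function whose limit is `hlim`, because
  -- the law is quadratic in the vector.
  have hkey := M.abs_integral_law_le (δ t) hf hbt.1 (s := σ * |t|) (by positivity) N
  have hlawt : (M.law (t⁻¹ • δ t)).real B = t⁻¹ ^ 2 * (M.law (δ t)).real B := by
    rw [law_real _ _ hm, law_real _ _ hm, ← Complex.coe_smul, map_smul, inner_smul_left,
      inner_smul_right, Complex.conj_ofReal, ← mul_assoc, ← Complex.ofReal_mul,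
      Complex.re_ofReal_mul]
    ring
  rw [dist_zero_right, norm_smul, Real.norm_eq_abs, Real.norm_eq_abs, hlawt, norm_smul,
    Real.norm_eq_abs, abs_inv]
  calc |t|⁻¹ * |∫ ω, f ω ∂(M.law (δ t))|
      ≤ |t|⁻¹ * (N * ‖δ t‖ ^ 2 + σ * |t| / 2 * C + (σ * |t|)⁻¹ / 2 * (M.law (δ t)).real B) := by
        gcongr
        refine hkey.trans ?_
        gcongr
        exact hbt.2
    _ = _ := by
        rw [← sq_abs t⁻¹, abs_inv]
        field_simp

/-- The derivative of the expectation along a curve of vectors. -/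
theorem hasDerivAt_integral_law [CompleteSpace H] (M : POVM Ω H) {γ : ℝ → H} {d : H}
    (hγ : HasDerivAt γ d 0) {f : Ω → ℝ} (hf : Measurable f) {C : ℝ}
    (hb : ∀ᶠ t in 𝓝 0, Integrable (fun ω => f ω ^ 2) (M.law (γ t)) ∧
      ∫ ω, f ω ^ 2 ∂(M.law (γ t)) ≤ C) :
    HasDerivAt (fun t => ∫ ω, f ω ∂(M.law (γ t))) (2 * (M.weakIntegral d (γ 0) f).re) 0 := by
  have h00 := hb.self_of_nhds
  -- As an inner product with the fixed vector `x`, the cross term inherits differentiability from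
  -- `γ`.
  obtain ⟨x, hx⟩ := M.exists_inner_eq_weakIntegral (γ 0) hf h00.1
  have hδ : HasDerivAt (fun t => γ t - γ 0) d 0 := hγ.sub_const _
  have hδb : ∀ᶠ t in 𝓝 0, Integrable (fun ω => f ω ^ 2) (M.law (γ t - γ 0)) ∧
      ∫ ω, f ω ^ 2 ∂(M.law (γ t - γ 0)) ≤ 2 * (C + C) := by
    filter_upwards [hb] with t ht
    have hn : Integrable (fun ω => f ω ^ 2) (M.law (-γ 0)) := by rw [law_neg]; exact h00.1
    rw [sub_eq_add_neg]
    refine ⟨M.integrable_law_add ht.1 hn, ?_⟩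
    refine (M.integral_law_add_le (fun ω => sq_nonneg _) ht.1 hn).trans ?_
    rw [law_neg]
    linarith [ht.2, h00.2]
  have hR := M.hasDerivAt_integral_law_zero hδ (sub_self _) hf hδb
  have hI : HasDerivAt (fun t => 2 * (inner ℂ (γ t - γ 0) x).re) (2 * (inner ℂ d x).re) 0 := by
    have h1 : HasDerivAt (fun t => inner ℂ (γ t - γ 0) x) (inner ℂ d x) 0 := by
      exact (hδ.inner ℂ (hasDerivAt_const (0 : ℝ) x)).congr_deriv (by simp)
    exact (Complex.reCLM.hasFDerivAt.comp_hasDerivAt (0 : ℝ) h1).const_mul 2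
  have := (hR.const_add (∫ ω, f ω ∂(M.law (γ 0)))).add hI
  rw [zero_add, hx] at this
  refine this.congr_of_eventuallyEq ?_
  filter_upwards [hδb] with t ht
  have h := M.integral_law_add hf h00.1 ht.1
  rw [add_sub_cancel] at h
  rw [h, ← hx]
  rfl

end POVM

/-! ### Local unbiasedness and the covariance inequality -/

namespace POVM

variable {m : ℕ} {H : Type u} [NormedAddCommGroup H] [InnerProductSpace ℂ H]

theorem HasFiniteSecondMoments.memLp {M : POVM (Fin m → ℝ) H} {ψ : H}
    (h : M.HasFiniteSecondMoments ψ) (θ : Fin m → ℝ) (i : Fin m) :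
    MemLp (fun ω => ω i - θ i) 2 (M.law ψ) :=
  ((memLp_two_iff_integrable_sq (measurable_pi_apply i).aestronglyMeasurable).2 (h i)).sub
    (memLp_const _)

theorem HasFiniteSecondMoments.integrable_sq {M : POVM (Fin m → ℝ) H} {ψ : H}
    (h : M.HasFiniteSecondMoments ψ) (θ : Fin m → ℝ) (i : Fin m) :
    Integrable (fun ω => (ω i - θ i) ^ 2) (M.law ψ) :=
  (h.memLp θ i).integrable_sq

theorem HasFiniteSecondMoments.integrable {M : POVM (Fin m → ℝ) H} {ψ : H}
    (h : M.HasFiniteSecondMoments ψ) (i : Fin m) : Integrable (fun ω => ω i) (M.law ψ) :=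
  integrable_of_sq (measurable_pi_apply i) (h i)

theorem measurable_coord_sub (θ : Fin m → ℝ) (i : Fin m) :
    Measurable fun ω : Fin m → ℝ => ω i - θ i := by fun_prop

theorem isEstimationVector_iff {M : POVM (Fin m → ℝ) H} {ψ : H}
    (h : M.HasFiniteSecondMoments ψ) (θ : Fin m → ℝ) (i : Fin m) (x : H) :
    M.IsEstimationVector θ ψ i x ↔
      ∀ χ, inner ℂ χ x = M.weakIntegral χ ψ fun ω => ω i - θ i :=
  ⟨fun hx χ => (hx χ).2, fun hx χ =>
    ⟨M.integrable_complexMeasure χ ψ (measurable_coord_sub θ i) (h.integrable_sq θ i), hx χ⟩⟩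

theorem integral_coord_sub {M : POVM (Fin m → ℝ) H} {ψ : H} (h : M.HasFiniteSecondMoments ψ)
    (h1 : ‖ψ‖ = 1) (θ : Fin m → ℝ) (i : Fin m) :
    ∫ ω, (ω i - θ i) ∂(M.law ψ) = M.mean ψ i - θ i := by
  rw [integral_sub (h.integrable i) (integrable_const _), integral_const, law_real_univ, h1]
  simp [mean]

theorem inner_estimationVector {M : POVM (Fin m → ℝ) H} {ψ : H} (h : M.HasFiniteSecondMoments ψ)
    (h1 : ‖ψ‖ = 1) {θ : Fin m → ℝ} {i : Fin m} {x : H} (hx : M.IsEstimationVector θ ψ i x) :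
    inner ℂ ψ x = ((M.mean ψ i - θ i : ℝ) : ℂ) := by
  rw [(isEstimationVector_iff h θ i x).1 hx ψ, M.weakIntegral_self ψ
    (integrable_of_sq (measurable_coord_sub θ i) (h.integrable_sq θ i)), integral_coord_sub h h1]

theorem hasDerivAt_mean [CompleteSpace H] {M : POVM (Fin m → ℝ) H} {φ : (Fin m → ℝ) → H}
    {θ : Fin m → ℝ} (hd : DifferentiableAt ℝ φ θ) (h1 : ∀ᶠ η in 𝓝 θ, ‖φ η‖ = 1)
    (hM : M.HasLocallyBoundedSecondMoments φ θ) {i : Fin m} {x : H}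
    (hx : M.IsEstimationVector θ (φ θ) i x) (j : Fin m) :
    HasDerivAt (fun t : ℝ => M.mean (φ (θ + t • Pi.single j 1)) i)
      (2 * (inner ℂ (fderiv ℝ φ θ (Pi.single j 1)) x).re) 0 := by
  obtain ⟨C, hC⟩ := hM
  have hline : HasDerivAt (fun t : ℝ => θ + t • (Pi.single j 1 : Fin m → ℝ)) (Pi.single j 1) 0 := by
    simpa using ((hasDerivAt_id (0 : ℝ)).smul_const (Pi.single j 1 : Fin m → ℝ)).const_add θ
  have h0 : θ + (0 : ℝ) • (Pi.single j 1 : Fin m → ℝ) = θ := by simp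
  have hγ : HasDerivAt (fun t : ℝ => φ (θ + t • Pi.single j 1))
      (fderiv ℝ φ θ (Pi.single j 1)) 0 := by
    have hd' : HasFDerivAt φ (fderiv ℝ φ θ) (θ + (0 : ℝ) • (Pi.single j 1 : Fin m → ℝ)) := by
      rw [h0]; exact hd.hasFDerivAt
    exact hd'.comp_hasDerivAt (0 : ℝ) hline
  have ht : Tendsto (fun t : ℝ => θ + t • (Pi.single j 1 : Fin m → ℝ)) (𝓝 0) (𝓝 θ) := by
    simpa using hline.continuousAt.tendsto
  have hb : ∀ᶠ η in 𝓝 θ, Integrable (fun ω : Fin m → ℝ => (ω i - θ i) ^ 2) (M.law (φ η)) ∧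
      ∫ ω, (ω i - θ i) ^ 2 ∂(M.law (φ η)) ≤ 2 * C + 2 * θ i ^ 2 := by
    filter_upwards [hC, h1] with η hη hη1
    have hi := hη.1.integrable_sq θ i
    refine ⟨hi, ?_⟩
    calc ∫ ω, (ω i - θ i) ^ 2 ∂(M.law (φ η))
        ≤ ∫ ω, (2 * ω i ^ 2 + 2 * θ i ^ 2) ∂(M.law (φ η)) := by
          refine integral_mono hi (((hη.1 i).const_mul 2).add (integrable_const _)) fun ω => ?_
          change (ω i - θ i) ^ 2 ≤ 2 * ω i ^ 2 + 2 * θ i ^ 2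
          nlinarith [sq_nonneg (ω i + θ i)]
      _ = 2 * ∫ ω, ω i ^ 2 ∂(M.law (φ η)) + 2 * θ i ^ 2 := by
          rw [integral_add ((hη.1 i).const_mul 2) (integrable_const _), integral_const_mul,
            integral_const, law_real_univ, hη1]
          simp
      _ ≤ _ := by linarith [hη.2 i]
  have hmain := M.hasDerivAt_integral_law hγ (measurable_coord_sub θ i) (ht.eventually hb)
  have hfin := hC.self_of_nhds.1
  simp only [h0] at hmain
  rw [← (isEstimationVector_iff hfin θ i x).1 hx] at hmain
  refine (hmain.add_const (θ i)).congr_of_eventuallyEq ?_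
  filter_upwards [ht.eventually hC, ht.eventually h1] with t ht ht1
  rw [integral_coord_sub ht.1 ht1, sub_add_cancel]

/-- The component along `φ` vanishes against `x ⟂ φ`; the factor 2 of the lift is the one from
differentiating a quadratic form, so the two forms of unbiasedness match. -/
theorem inner_horizontalLift_left (φ : (Fin m → ℝ) → H) (θ : Fin m → ℝ) (j : Fin m) {x : H}
    (hx : inner ℂ (φ θ) x = (0 : ℂ)) :
    (inner ℂ (horizontalLift φ θ j) x).re =
      2 * (inner ℂ (fderiv ℝ φ θ (Pi.single j 1)) x).re := by
  simp [horizontalLift, hx, mul_comm]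

/-- Local unbiasedness in terms of estimation vectors and in terms of expectations agree. -/
theorem isLocallyUnbiasedInMean_iff [CompleteSpace H] {M : POVM (Fin m → ℝ) H}
    {φ : (Fin m → ℝ) → H} {θ : Fin m → ℝ} (hd : DifferentiableAt ℝ φ θ)
    (h1 : ∀ᶠ η in 𝓝 θ, ‖φ η‖ = 1) (hM : M.HasLocallyBoundedSecondMoments φ θ) :
    M.IsLocallyUnbiasedInMean φ θ ↔ M.IsLocallyUnbiased θ (φ θ) (horizontalLift φ θ) := by
  have hfin : M.HasFiniteSecondMoments (φ θ) := by
    obtain ⟨C, hC⟩ := hM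
    exact hC.self_of_nhds.1
  have hn := h1.self_of_nhds
  constructor
  · rintro ⟨-, hmean, hder⟩
    choose x hx using fun i => M.exists_inner_eq_weakIntegral (φ θ) (measurable_coord_sub θ i)
      (hfin.integrable_sq θ i)
    have hxe : ∀ i, M.IsEstimationVector θ (φ θ) i (x i) := fun i =>
      (isEstimationVector_iff hfin θ i (x i)).2 (hx i)
    have h0 : ∀ i, inner ℂ (φ θ) (x i) = (0 : ℂ) := fun i => by
      rw [inner_estimationVector hfin hn (hxe i), hmean i]
      simp
    refine ⟨hfin, x, hxe, h0, fun i j => ?_⟩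
    rw [inner_horizontalLift_left φ θ j (h0 i)]
    exact (hasDerivAt_mean hd h1 hM (hxe i) j).unique (hder i j)
  · rintro ⟨-, x, hxe, h0, hl⟩
    refine ⟨?_, fun i => ?_, fun i j => ?_⟩
    · obtain ⟨C, hC⟩ := hM
      exact hC.mono fun η hη i => hη.1.integrable i
    · have := inner_estimationVector hfin hn (hxe i)
      rw [h0 i] at this
      have h : M.mean (φ θ) i - θ i = 0 := by exact_mod_cast this.symm
      linarith
    · rw [← hl i j, inner_horizontalLift_left φ θ j (h0 i)]
      exact hasDerivAt_mean hd h1 hM (hxe i) j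

open scoped ComplexOrder in
/-- The covariance matrix dominates the Gram matrix of the estimation vectors. -/
theorem posSemidef_cov_sub {M : POVM (Fin m → ℝ) H} {ψ : H} (h : M.HasFiniteSecondMoments ψ)
    {θ : Fin m → ℝ} {x : Fin m → H} (hx : ∀ i, M.IsEstimationVector θ ψ i (x i)) :
    (Matrix.of fun i j => ((M.cov θ ψ i j : ℝ) : ℂ) - inner ℂ (x i) (x j)).PosSemidef := by
  have hprod : ∀ i j, Integrable (fun ω : Fin m → ℝ => (ω i - θ i) * (ω j - θ j)) (M.law ψ) :=
    fun i j => (h.memLp θ i).integrable_mul (h.memLp θ j)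
  refine Matrix.PosSemidef.of_dotProduct_mulVec_nonneg ?_ fun c => ?_
  · ext i j
    simp only [Matrix.conjTranspose_apply, Matrix.of_apply, star_sub, RCLike.star_def,
      Complex.conj_ofReal, inner_conj_symm, cov, mul_comm]
  · set X := ∑ i, c i • x i with hX
    set S := ∫ ω, ‖∑ i, c i * ((ω i - θ i : ℝ) : ℂ)‖ ^ 2 ∂(M.law ψ) with hS
    -- Cauchy–Schwarz is tested at `χ = X` itself, giving `‖X‖⁴ ≤ ‖X‖² S`, from which `‖X‖²` is
    -- cancelled.
    have hXw : inner ℂ X X = ∑ i, c i * M.weakIntegral X ψ fun ω => ω i - θ i := by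
      conv_lhs => rw [hX, inner_sum]
      refine Finset.sum_congr rfl fun i _ => ?_
      rw [inner_smul_right, ← (isEstimationVector_iff h θ i (x i)).1 (hx i)]
    have hle := M.sq_norm_sum_mul_weakIntegral_le X ψ (fun i => measurable_coord_sub θ i)
      (fun i => h.integrable_sq θ i) c
    rw [← hXw, ← hS, inner_self_eq_norm_sq_to_K] at hle
    have hXS : ‖X‖ ^ 2 ≤ S := by
      have hle' : ‖X‖ ^ 2 * ‖X‖ ^ 2 ≤ ‖X‖ ^ 2 * S := by simpa [← sq] using hle
      rcases (sq_nonneg ‖X‖).eq_or_lt with h0 | h0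
      · rw [← h0]
        exact integral_nonneg fun _ => by positivity
      · exact le_of_mul_le_mul_left hle' h0
    have hSc : (S : ℂ) = ∑ i, ∑ j, star (c i) * ((M.cov θ ψ i j : ℝ) : ℂ) * c j := by
      rw [hS, ← integral_complex_ofReal]
      have : ∀ ω : Fin m → ℝ, ((‖∑ i, c i * ((ω i - θ i : ℝ) : ℂ)‖ ^ 2 : ℝ) : ℂ) =
          ∑ i, ∑ j, star (c i) * c j * (((ω i - θ i) * (ω j - θ j) : ℝ) : ℂ) := by
        intro ω
        rw [Complex.ofReal_pow, ← Complex.conj_mul', map_sum, Finset.sum_mul_sum]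
        refine Finset.sum_congr rfl fun i _ => Finset.sum_congr rfl fun j _ => ?_
        rw [map_mul, Complex.conj_ofReal, Complex.ofReal_mul, RCLike.star_def]
        ring
      simp only [this]
      rw [integral_finsetSum _ fun i _ => integrable_finsetSum _ fun j _ =>
        (hprod i j).ofReal.const_mul _]
      refine Finset.sum_congr rfl fun i _ => ?_
      rw [integral_finsetSum _ fun j _ => (hprod i j).ofReal.const_mul _]
      refine Finset.sum_congr rfl fun j _ => ?_
      rw [integral_const_mul, integral_complex_ofReal, cov, Matrix.of_apply]
      ring
    have hXc : ((‖X‖ ^ 2 : ℝ) : ℂ) = ∑ i, ∑ j, star (c i) * inner ℂ (x i) (x j) * c j := by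
      have : ((‖X‖ ^ 2 : ℝ) : ℂ) = inner ℂ X X := by
        rw [inner_self_eq_norm_sq_to_K]; simp
      rw [this, hX, sum_inner]
      refine Finset.sum_congr rfl fun i _ => ?_
      rw [inner_sum]
      refine Finset.sum_congr rfl fun j _ => ?_
      rw [inner_smul_left, inner_smul_right, RCLike.star_def]
      ring
    have : star c ⬝ᵥ (Matrix.of fun i j => ((M.cov θ ψ i j : ℝ) : ℂ) - inner ℂ (x i) (x j)).mulVec c
        = ((S - ‖X‖ ^ 2 : ℝ) : ℂ) := by
      rw [Complex.ofReal_sub, hSc, hXc, ← Finset.sum_sub_distrib]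
      refine Finset.sum_congr rfl fun i _ => ?_
      rw [← Finset.sum_sub_distrib, Matrix.mulVec, dotProduct, Finset.mul_sum]
      refine Finset.sum_congr rfl fun j _ => ?_
      rw [Matrix.of_apply, Pi.star_apply]
      ring
    rw [this]
    exact_mod_cast sub_nonneg.2 hXS

end POVM

/-! ### Gram matrices, isometries and real bases -/

section Geometry

variable {𝕜 : Type*} [RCLike 𝕜] {ι : Type*} [Fintype ι]

theorem norm_sum_smul_eq_of_gram_eq {E F : Type*} [NormedAddCommGroup E] [InnerProductSpace 𝕜 E]
    [NormedAddCommGroup F] [InnerProductSpace 𝕜 F] {v : ι → E} {w : ι → F}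
    (h : ∀ i j, inner 𝕜 (v i) (v j) = inner 𝕜 (w i) (w j)) (c : ι → 𝕜) :
    ‖∑ i, c i • w i‖ = ‖∑ i, c i • v i‖ := by
  rw [norm_eq_sqrt_re_inner (𝕜 := 𝕜), norm_eq_sqrt_re_inner (𝕜 := 𝕜)]
  simp only [sum_inner, inner_sum, inner_smul_left, inner_smul_right, h]

/-- Families with the same Gram matrix are related by a linear isometry of their spans. -/
theorem exists_isometry_range_of_gram_eq {E F : Type*} [NormedAddCommGroup E]
    [InnerProductSpace 𝕜 E] [NormedAddCommGroup F] [InnerProductSpace 𝕜 F] {v : ι → E} {w : ι → F}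
    (h : ∀ i j, inner 𝕜 (v i) (v j) = inner 𝕜 (w i) (w j)) :
    ∃ T : (LinearMap.range (Fintype.linearCombination 𝕜 v)) →ₗᵢ[𝕜] F, ∀ i (hi), T ⟨v i, hi⟩ = w i := by
  classical
  set f := Fintype.linearCombination 𝕜 v
  set g := Fintype.linearCombination 𝕜 w
  have hn : ∀ c, ‖g c‖ = ‖f c‖ := fun c => by
    simpa [f, g, Fintype.linearCombination_apply] using norm_sum_smul_eq_of_gram_eq h c
  have hker : LinearMap.ker f ≤ LinearMap.ker g := fun c hc => by
    rw [LinearMap.mem_ker] at hc ⊢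
    rw [← norm_eq_zero, hn, hc, norm_zero]
  let T₀ := ((LinearMap.ker f).liftQ g hker).comp f.quotKerEquivRange.symm.toLinearMap
  have hT : ∀ c (hc), T₀ ⟨f c, hc⟩ = g c := fun c hc => by
    simp [T₀]
  refine ⟨⟨T₀, ?_⟩, fun i hi => ?_⟩
  · rintro ⟨_, c, rfl⟩
    exact (congrArg norm (hT c ⟨c, rfl⟩)).trans (hn c)
  · have hfi : f (Pi.single i 1) = v i := by simp [f]
    have hgi : g (Pi.single i 1) = w i := by simp [g]
    have := hT (Pi.single i 1) ⟨_, rfl⟩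
    rw [hgi] at this
    have h' : T₀ ⟨v i, hi⟩ = w i := by simpa only [hfi] using this
    exact h'

theorem exists_isometry_of_finrank_le {E F : Type*} [NormedAddCommGroup E]
    [InnerProductSpace 𝕜 E] [FiniteDimensional 𝕜 E] [NormedAddCommGroup F] [InnerProductSpace 𝕜 F]
    [FiniteDimensional 𝕜 F] (h : Module.finrank 𝕜 E ≤ Module.finrank 𝕜 F) :
    Nonempty (E →ₗᵢ[𝕜] F) := by
  let b := stdOrthonormalBasis 𝕜 E
  let b' := stdOrthonormalBasis 𝕜 F
  let f := b.toBasis.constr 𝕜 fun i => b' (Fin.castLE h i)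
  refine ⟨f.isometryOfOrthonormal (v := b.toBasis) (by simp) ?_⟩
  have : (f ∘ b.toBasis) = b' ∘ Fin.castLE h := by
    ext i
    exact b.toBasis.constr_basis 𝕜 _ i
  rw [this]
  exact b'.orthonormal.comp _ (Fin.castLE_injective h)

/-- A family in `E` and a family in `F` with the same Gram matrix are related by a linear isometry
`E → F` if the dimension of `F` is at least that of `E`. -/
theorem exists_isometry_of_gram_eq {E F : Type*} [NormedAddCommGroup E]
    [InnerProductSpace 𝕜 E] [FiniteDimensional 𝕜 E] [NormedAddCommGroup F] [InnerProductSpace 𝕜 F]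
    [FiniteDimensional 𝕜 F] (hd : Module.finrank 𝕜 E ≤ Module.finrank 𝕜 F) {v : ι → E} {w : ι → F}
    (h : ∀ i j, inner 𝕜 (v i) (v j) = inner 𝕜 (w i) (w j)) :
    ∃ T : E →ₗᵢ[𝕜] F, ∀ i, T (v i) = w i := by
  classical
  -- Placing `E` inside `F` first makes the Gram isometry a map from a subspace of `F` to `F`, which
  -- extends to all of `F` by finite dimension.
  obtain ⟨J⟩ := exists_isometry_of_finrank_le (𝕜 := 𝕜) hd
  obtain ⟨T, hT⟩ := exists_isometry_range_of_gram_eq (𝕜 := 𝕜) (v := fun i => J (v i)) (w := w)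
    (fun i j => by rw [J.inner_map_map, h])
  refine ⟨T.extend.comp J, fun i => ?_⟩
  have hi : J (v i) ∈ LinearMap.range (Fintype.linearCombination 𝕜 fun i => J (v i)) :=
    ⟨Pi.single i 1, by simp⟩
  rw [← hT i hi, ← LinearIsometry.extend_apply]
  rfl

/-- A family of at most `dim F` vectors whose first members have the Gram matrix of a family in `F`
can be moved into `F` compatibly with that family. -/
theorem exists_extend_family {κ : Type*} [Fintype κ] {E F : Type*} [NormedAddCommGroup E]
    [InnerProductSpace 𝕜 E] [NormedAddCommGroup F] [InnerProductSpace 𝕜 F]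
    [FiniteDimensional 𝕜 F] (hd : Fintype.card ι + Fintype.card κ ≤ Module.finrank 𝕜 F)
    (v : ι → E) (y : κ → E) {w : ι → F}
    (h : ∀ i j, inner 𝕜 (v i) (v j) = inner 𝕜 (w i) (w j)) :
    ∃ z : κ → F, (∀ i k, inner 𝕜 (w i) (z k) = inner 𝕜 (v i) (y k)) ∧
      ∀ k l, inner 𝕜 (z k) (z l) = inner 𝕜 (y k) (y l) := by
  -- Only this span has to fit into `F`; `E` may be infinite dimensional.
  let S := Submodule.span 𝕜 (Set.range (Sum.elim v y))
  have : FiniteDimensional 𝕜 S := FiniteDimensional.span_of_finite 𝕜 (Set.finite_range _)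
  have hS : Module.finrank 𝕜 S ≤ Module.finrank 𝕜 F := by
    refine (finrank_range_le_card (R := 𝕜) (Sum.elim v y)).trans ?_
    rwa [Fintype.card_sum]
  have hmem : ∀ s, Sum.elim v y s ∈ S := fun s => Submodule.subset_span ⟨s, rfl⟩
  obtain ⟨T, hT⟩ := exists_isometry_of_gram_eq (𝕜 := 𝕜) hS
    (v := fun i => (⟨v i, hmem (Sum.inl i)⟩ : S)) (w := w) (fun i j => h i j)
  refine ⟨fun k => T ⟨y k, hmem (Sum.inr k)⟩, fun i k => ?_, fun k l => ?_⟩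
  · rw [← hT i, T.inner_map_map]
    rfl
  · rw [T.inner_map_map]
    rfl

open scoped ComplexOrder in
/-- A positive semidefinite matrix is a Gram matrix. -/
theorem _root_.Matrix.PosSemidef.exists_inner_eq {D : Matrix ι ι 𝕜} (hD : D.PosSemidef) :
    ∃ (r : ℕ) (z : ι → EuclideanSpace 𝕜 (Fin r)), ∀ i j, inner 𝕜 (z i) (z j) = D i j := by
  obtain ⟨r, v, hv⟩ := Matrix.posSemidef_iff_eq_sum_vecMulVec.1 hD
  refine ⟨r, fun i => WithLp.toLp 2 fun k => star (v k i), fun i j => ?_⟩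
  rw [hv, Matrix.sum_apply]
  simp [PiLp.inner_apply, Matrix.vecMulVec_apply, mul_comm]

end Geometry
/-- Vectors with real inner products have real coordinates in some orthonormal basis, in which the
coordinates of the first vector are all equal. -/
theorem exists_orthonormalBasis_real {K : Type*} [NormedAddCommGroup K] [InnerProductSpace ℂ K]
    [FiniteDimensional ℂ K] {m n : ℕ} (hn : Module.finrank ℂ K = n) (hmn : m + 1 ≤ n) {φ : K}
    (hφ : inner ℂ φ φ = (1 : ℂ)) {x : Fin m → K} (hx : ∀ i, inner ℂ φ (x i) = (0 : ℂ))
    (hxx : ∀ i j, (inner ℂ (x i) (x j) : ℂ).im = 0) :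
    ∃ (e : OrthonormalBasis (Fin n) ℂ K) (a : ℝ) (r : Fin m → Fin n → ℝ), a ≠ 0 ∧
      (∀ k, inner ℂ (e k) φ = (a : ℂ)) ∧ ∀ i k, inner ℂ (e k) (x i) = (r i k : ℂ) := by
  let _ : InnerProductSpace ℝ K := InnerProductSpace.complexToReal
  have hn0 : (0 : ℝ) < n := by exact_mod_cast (by omega : 0 < n)
  -- This makes the constant vector `w` a unit vector like `φ`; its coordinates are nonzero, so they
  -- may be divided by later.
  let a : ℝ := (Real.sqrt n)⁻¹
  have ha : a ≠ 0 := by positivity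
  have haa : n * (a * a) = 1 := by
    simp only [a]
    rw [← mul_inv, Real.mul_self_sqrt hn0.le, mul_inv_cancel₀ hn0.ne']
  let w : EuclideanSpace ℝ (Fin n) := WithLp.toLp 2 fun _ => a
  have hww : inner ℝ w w = (1 : ℝ) := by
    rw [PiLp.inner_apply, ← haa]
    change ∑ _k : Fin n, a * a = _
    simp
  -- In the underlying real inner product space, the `x i` are moved into `ℝⁿ` with `φ` going to
  -- `w`.
  obtain ⟨y, hwy, hyy⟩ := exists_extend_family (𝕜 := ℝ) (ι := Unit) (κ := Fin m)
    (F := EuclideanSpace ℝ (Fin n)) (by simp; omega) (fun _ => φ) x (w := fun _ => w)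
    (fun _ _ => by
      rw [real_inner_eq_re_inner ℂ, hφ, hww]
      simp)
  let c : EuclideanSpace ℝ (Fin n) → EuclideanSpace ℂ (Fin n) := fun v =>
    WithLp.toLp 2 fun k => ((v k : ℝ) : ℂ)
  have hc : ∀ v v', inner ℂ (c v) (c v') = ((inner ℝ v v' : ℝ) : ℂ) := fun v v' => by
    simp [c, PiLp.inner_apply]
  -- Since all inner products are real, the complex Gram matrices agree as well. The resulting
  -- isometry `ℂⁿ → K` is onto by dimension and carries the standard basis to `e`.
  obtain ⟨T, hT⟩ := exists_isometry_of_gram_eq (𝕜 := ℂ) (ι := Option (Fin m))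
    (E := EuclideanSpace ℂ (Fin n)) (F := K) (by simp [hn])
    (v := fun s => s.elim (c w) fun i => c (y i)) (w := fun s => s.elim φ x) (by
      have hre : ∀ i j, ((inner ℝ (x i) (x j) : ℝ) : ℂ) = inner ℂ (x i) (x j) := fun i j => by
        rw [real_inner_eq_re_inner ℂ]
        exact Complex.ext (by simp) (by simp [hxx])
      have h0 : ∀ i, inner ℝ w (y i) = 0 := fun i => by
        rw [hwy (), real_inner_eq_re_inner ℂ, hx]; simp
      rintro (_ | i) (_ | j)
      · simp only [Option.elim_none]
        rw [hc, hφ, hww, Complex.ofReal_one]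
      · simp only [Option.elim_none, Option.elim_some]
        rw [hc, h0, hx]
        simp
      · simp only [Option.elim_none, Option.elim_some]
        rw [hc, real_inner_comm, h0, ← inner_conj_symm, hx]
        simp
      · simp only [Option.elim_some]
        rw [hc, hyy, hre])
  let T' := T.toLinearIsometryEquiv (by simp [hn])
  let e := (EuclideanSpace.basisFun (Fin n) ℂ).map T'
  have he : ∀ k v, inner ℂ (e k) (T v) = v k := fun k v => by
    change inner ℂ (T ((EuclideanSpace.basisFun (Fin n) ℂ) k)) (T v) = v k
    rw [T.inner_map_map, ← OrthonormalBasis.repr_apply_apply, EuclideanSpace.basisFun_repr]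
  refine ⟨e, a, fun i k => y i k, ha, fun k => ?_, fun i k => ?_⟩
  · rw [← show T (c w) = φ from hT none, he]
  · rw [← show T (c (y i)) = x i from hT (some i), he]

/-! ### Measurements with finitely many outcomes -/

namespace POVM

section Discrete

variable {Ω : Type*} [MeasurableSpace Ω] {H : Type*} [NormedAddCommGroup H]
  [InnerProductSpace ℂ H] {ι : Type*} [Fintype ι]

open Classical in
/-- The measurement with finitely many outcomes `p k` and effects `A k`. -/
def discrete (p : ι → Ω) (A : ι → H →L[ℂ] H) (hA : ∀ k, (A k).IsPositive) (h1 : ∑ k, A k = 1) :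
    POVM Ω H where
  op B := ∑ k, if p k ∈ B then A k else 0
  op_empty := by simp
  op_univ := by simp [h1]
  isPositive B _ := by
    refine Finset.sum_induction _ _ (fun _ _ => ContinuousLinearMap.IsPositive.add)
      ContinuousLinearMap.isPositive_zero fun k _ => ?_
    split_ifs
    exacts [hA k, ContinuousLinearMap.isPositive_zero]
  hasSum B hB hd ψ := by
    have key : ∀ k, HasSum (fun n => if p k ∈ B n then A k ψ else 0)
        (if p k ∈ ⋃ n, B n then A k ψ else 0) := fun k => by
      have h := (VectorMeasure.dirac (p k) (A k ψ)).m_iUnion hB hd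
      have hd : ∀ C, MeasurableSet C →
          VectorMeasure.dirac (p k) (A k ψ) C = if p k ∈ C then A k ψ else 0 := fun C hC => by
        split_ifs with h <;> simp [h, hC]
      rw [hd _ (MeasurableSet.iUnion hB)] at h
      simpa only [hd _ (hB _)] using h
    have h := hasSum_sum (s := Finset.univ) fun k _ => key k
    have hop : ∀ C : Set Ω, (∑ k, if p k ∈ C then A k else 0) ψ =
        ∑ k, if p k ∈ C then A k ψ else 0 := fun C => by
      rw [_root_.sum_apply]
      refine Finset.sum_congr rfl fun k _ => ?_
      split_ifs <;> simp
    simpa only [hop] using h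

variable (p : ι → Ω) (A : ι → H →L[ℂ] H) (hA : ∀ k, (A k).IsPositive) (h1 : ∑ k, A k = 1)

theorem complexMeasure_discrete (χ ψ : H) : (discrete p A hA h1).complexMeasure χ ψ =
    ∑ k, VectorMeasure.dirac (p k) (inner ℂ χ (A k ψ)) := by
  classical
  ext B hB
  rw [complexMeasure_apply _ _ _ hB, FunLike.coe_sum, Finset.sum_apply]
  simp only [discrete, _root_.sum_apply, inner_sum]
  refine Finset.sum_congr rfl fun k _ => ?_
  split_ifs with h <;> simp [h, hB]

theorem law_discrete (ψ : H) : (discrete p A hA h1).law ψ =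
    ∑ k, ENNReal.ofReal (inner ℂ ψ (A k ψ)).re • Measure.dirac (p k) := by
  classical
  ext B hB
  rw [law_apply _ _ hB, Measure.finsetSum_apply]
  simp only [discrete, _root_.sum_apply, inner_sum, Complex.re_sum]
  rw [ENNReal.ofReal_sum_of_nonneg]
  · refine Finset.sum_congr rfl fun k _ => ?_
    split_ifs with h <;> simp [h, hB]
  · intro k _
    split_ifs
    · exact (hA k).re_inner_nonneg_right ψ
    · simp

variable [MeasurableSingletonClass Ω]

theorem integrable_law_discrete (ψ : H) (f : Ω → ℝ) :
    Integrable f ((discrete p A hA h1).law ψ) := by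
  rw [law_discrete, integrable_finsetSum_measure]
  intro k _
  exact (integrable_dirac (by simp)).smul_measure ENNReal.ofReal_ne_top

theorem integral_law_discrete (ψ : H) (f : Ω → ℝ) :
    ∫ ω, f ω ∂((discrete p A hA h1).law ψ) = ∑ k, (inner ℂ ψ (A k ψ)).re * f (p k) := by
  rw [law_discrete, integral_finsetSum_measure fun k _ =>
    (integrable_dirac (by simp)).smul_measure ENNReal.ofReal_ne_top]
  refine Finset.sum_congr rfl fun k _ => ?_
  rw [integral_smul_measure, integral_dirac, smul_eq_mul,
    ENNReal.toReal_ofReal (by exact (hA k).re_inner_nonneg_right ψ)]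

theorem weakIntegral_discrete (χ ψ : H) (f : Ω → ℝ) :
    (discrete p A hA h1).weakIntegral χ ψ f = ∑ k, f (p k) * inner ℂ χ (A k ψ) := by
  rw [weakIntegral, complexMeasure_discrete, VectorMeasure.integral_finsetSum_vectorMeasure]
  · refine Finset.sum_congr rfl fun k _ => ?_
    rw [VectorMeasure.integral_dirac]
    simp
  · intro k _
    rw [VectorMeasure.Integrable, VectorMeasure.variation_dirac]
    exact (integrable_dirac (by simp)).smul_measure (by simp)

end Discrete

theorem hasFiniteSecondMoments_discrete {m : ℕ} {H : Type*} [NormedAddCommGroup H]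
    [InnerProductSpace ℂ H] {ι : Type*} [Fintype ι] (p : ι → Fin m → ℝ) (A : ι → H →L[ℂ] H)
    (hA : ∀ k, (A k).IsPositive) (h1 : ∑ k, A k = 1) (ψ : H) :
    (discrete p A hA h1).HasFiniteSecondMoments ψ :=
  fun _ => integrable_law_discrete p A hA h1 ψ _

/-- In a unit state every outcome has weight at most 1, so a single constant serves all such states.
The measurements built from vectors therefore also meet the hypothesis of part (0). -/
theorem hasLocallyBoundedSecondMoments_discrete {m : ℕ} {H : Type*} [NormedAddCommGroup H]
    [InnerProductSpace ℂ H] {ι : Type*} [Fintype ι] (p : ι → Fin m → ℝ) (A : ι → H →L[ℂ] H)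
    (hA : ∀ k, (A k).IsPositive) (h1 : ∑ k, A k = 1) {φ : (Fin m → ℝ) → H} {θ : Fin m → ℝ}
    (hφ : ∀ᶠ η in 𝓝 θ, ‖φ η‖ = 1) :
    (discrete p A hA h1).HasLocallyBoundedSecondMoments φ θ := by
  refine ⟨∑ i, ∑ k, p k i ^ 2, hφ.mono fun η hη =>
    ⟨hasFiniteSecondMoments_discrete p A hA h1 _, fun i => ?_⟩⟩
  have hs : ∑ k, (inner ℂ (φ η) (A k (φ η))).re = 1 := by
    rw [← Complex.re_sum, ← inner_sum, ← _root_.sum_apply, h1]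
    simp [inner_self_eq_norm_sq_to_K, hη]
  have hle1 : ∀ k, (inner ℂ (φ η) (A k (φ η))).re ≤ 1 := fun k => by
    rw [← hs]
    exact Finset.single_le_sum (f := fun k => (inner ℂ (φ η) (A k (φ η))).re)
      (fun k _ => (hA k).re_inner_nonneg_right _) (Finset.mem_univ k)
  rw [integral_law_discrete]
  refine le_trans (Finset.sum_le_sum fun k _ => mul_le_of_le_one_left (sq_nonneg _) (hle1 k)) ?_
  exact Finset.single_le_sum (f := fun i => ∑ k, p k i ^ 2)
    (fun i _ => Finset.sum_nonneg fun k _ => sq_nonneg _) (Finset.mem_univ i)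

end POVM

/-! ### Realizing vector systems by measurements -/

namespace POVM

/-- A contraction `A` into a space with orthonormal basis `e` gives effects `|A†e_k⟩⟨A†e_k|`, which
together with `1 - A†A` form a resolution of the identity. -/
theorem exists_effects {H K : Type*} [NormedAddCommGroup H]
    [InnerProductSpace ℂ H] [CompleteSpace H] [NormedAddCommGroup K] [InnerProductSpace ℂ K]
    {n : ℕ} (e : OrthonormalBasis (Fin n) ℂ K) (A : H →L[ℂ] K) (hA : ∀ v, ‖A v‖ ≤ ‖v‖) :
    ∃ F : Option (Fin n) → H →L[ℂ] H, (∀ s, (F s).IsPositive) ∧ ∑ s, F s = 1 ∧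
      (∀ k u v, inner ℂ u (F (some k) v) = inner ℂ (A u) (e k) * inner ℂ (e k) (A v)) ∧
      ∀ u v, inner ℂ u (F none v) = inner ℂ u v - inner ℂ (A u) (A v) := by
  have : FiniteDimensional ℂ K := e.toBasis.finiteDimensional_of_finite
  have : CompleteSpace K := FiniteDimensional.complete ℂ K
  let F : Option (Fin n) → H →L[ℂ] H := fun s =>
    s.elim (1 - A.adjoint ∘L A) fun k => InnerProductSpace.rankOne ℂ (A.adjoint (e k)) (A.adjoint (e k))
  have hsome : ∀ k u v, inner ℂ u (F (some k) v) = inner ℂ (A u) (e k) * inner ℂ (e k) (A v) := by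
    intro k u v
    simp [F, ContinuousLinearMap.adjoint_inner_left, ContinuousLinearMap.adjoint_inner_right,
      mul_comm]
  have hnone : ∀ u v, inner ℂ u (F none v) = inner ℂ u v - inner ℂ (A u) (A v) := by
    intro u v
    simp [F, ContinuousLinearMap.adjoint_inner_right]
  refine ⟨F, ?_, ?_, hsome, hnone⟩
  · rintro (_ | k)
    · rw [ContinuousLinearMap.isPositive_iff_complex]
      intro v
      have h : inner ℂ (F none v) v = ((‖v‖ ^ 2 - ‖A v‖ ^ 2 : ℝ) : ℂ) := by
        rw [← inner_conj_symm, hnone, inner_self_eq_norm_sq_to_K, inner_self_eq_norm_sq_to_K]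
        simp
      rw [h]
      refine ⟨rfl, ?_⟩
      change 0 ≤ ‖v‖ ^ 2 - ‖A v‖ ^ 2
      have := pow_le_pow_left₀ (norm_nonneg _) (hA v) 2
      linarith
    · exact InnerProductSpace.isPositive_rankOne_self _
  · ext v
    refine ext_inner_left ℂ fun u => ?_
    rw [_root_.sum_apply, inner_sum, Fintype.sum_option, hnone]
    simp only [hsome]
    rw [e.sum_inner_mul_inner]
    simp

/-- Commuting real vectors in `K` are realized by a measurement with finitely many outcomes in
every space that contracts to `K`. -/
theorem exists_discrete_isLocallyUnbiased {m n : ℕ} {H K : Type*} [NormedAddCommGroup H]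
    [InnerProductSpace ℂ H] [CompleteSpace H] [NormedAddCommGroup K] [InnerProductSpace ℂ K]
    (e : OrthonormalBasis (Fin n) ℂ K) (A : H →L[ℂ] K) (hA : ∀ v, ‖A v‖ ≤ ‖v‖)
    (θ : Fin m → ℝ) {ψ : H} {l : Fin m → H} {x : Fin m → K} {a : ℝ} {r : Fin m → Fin n → ℝ}
    (ha : a ≠ 0) (hφ : ∀ k, inner ℂ (e k) (A ψ) = (a : ℂ))
    (hx : ∀ i k, inner ℂ (e k) (x i) = (r i k : ℂ))
    (hx0 : ∀ i, inner ℂ (A ψ) (x i) = (0 : ℂ))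
    (hxl : ∀ i j, (inner ℂ (A (l j)) (x i) : ℂ).re = if i = j then 1 else 0) :
    ∃ (p : Option (Fin n) → Fin m → ℝ) (F : Option (Fin n) → H →L[ℂ] H)
      (hF : ∀ s, (F s).IsPositive) (h1 : ∑ s, F s = 1),
      (discrete p F hF h1).IsLocallyUnbiased θ ψ l ∧
      (discrete p F hF h1).cov θ ψ = Matrix.of (fun i j => (inner ℂ (x i) (x j) : ℂ).re) ∧
      (∀ k u v, inner ℂ u (F (some k) v) = inner ℂ (A u) (e k) * inner ℂ (e k) (A v)) ∧
      ∀ u v, inner ℂ u (F none v) = inner ℂ u v - inner ℂ (A u) (A v) := by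
  have : FiniteDimensional ℂ K := e.toBasis.finiteDimensional_of_finite
  have : CompleteSpace K := FiniteDimensional.complete ℂ K
  obtain ⟨F, hF, h1, hsome, hnone⟩ := exists_effects e A hA
  -- Since `⟨e k|Aψ⟩ = a`, dividing by `a` restores the coordinate `r i k` in the estimation vector,
  -- and the weight `a²` of the law cancels in the covariance. The defect effect gets outcome `θ`
  -- and contributes to neither.
  let p : Option (Fin n) → Fin m → ℝ := fun s i => s.elim (θ i) fun k => θ i + r i k / a
  have hfin := hasFiniteSecondMoments_discrete p F hF h1 ψ
  have hac : (a : ℂ) ≠ 0 := by exact_mod_cast ha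
  have hinner : ∀ χ i, inner ℂ χ (A.adjoint (x i)) =
      (discrete p F hF h1).weakIntegral χ ψ fun ω => ω i - θ i := by
    intro χ i
    rw [ContinuousLinearMap.adjoint_inner_right, weakIntegral_discrete, Fintype.sum_option,
      ← e.sum_inner_mul_inner]
    simp only [p, hsome, Option.elim_none, Option.elim_some, sub_self, Complex.ofReal_zero,
      zero_mul, zero_add, hx, hφ, add_sub_cancel_left, Complex.ofReal_div]
    refine Finset.sum_congr rfl fun k _ => ?_
    field_simp
  refine ⟨p, F, hF, h1, ⟨hfin, fun i => A.adjoint (x i), fun i => ?_, fun i => ?_, fun i j => ?_⟩,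
    ?_, hsome, hnone⟩
  · exact (isEstimationVector_iff hfin θ i _).2 fun χ => hinner χ i
  · rw [ContinuousLinearMap.adjoint_inner_right, hx0]
  · rw [ContinuousLinearMap.adjoint_inner_right, hxl]
  · ext i j
    have hconj : ∀ i k, inner ℂ (x i) (e k) = (r i k : ℂ) := fun i k => by
      rw [← inner_conj_symm, hx, Complex.conj_ofReal]
    have hφc : ∀ k, inner ℂ (A ψ) (e k) = (a : ℂ) := fun k => by
      rw [← inner_conj_symm, hφ, Complex.conj_ofReal]
    rw [cov, Matrix.of_apply, Matrix.of_apply, integral_law_discrete, Fintype.sum_option,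
      ← e.sum_inner_mul_inner, Complex.re_sum]
    simp only [p, hsome, Option.elim_none, Option.elim_some, sub_self, mul_zero, zero_add, hx,
      hconj, hφ, hφc, add_sub_cancel_left, ← Complex.ofReal_mul, Complex.ofReal_re]
    refine Finset.sum_congr rfl fun k _ => ?_
    field_simp

end POVM

/-- A contraction of `H` into `K` that realizes a copy. -/
theorem exists_contraction_of_gram_eq {ι : Type*} [Fintype ι] {H K : Type*} [NormedAddCommGroup H]
    [InnerProductSpace ℂ H] [NormedAddCommGroup K] [InnerProductSpace ℂ K]
    {v : ι → H} {w : ι → K} (h : ∀ i j, inner ℂ (v i) (v j) = (inner ℂ (w i) (w j) : ℂ)) :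
    ∃ A : H →L[ℂ] K, (∀ u, ‖A u‖ ≤ ‖u‖) ∧ ∀ i, A (v i) = w i := by
  classical
  let S := LinearMap.range (Fintype.linearCombination ℂ v)
  obtain ⟨T, hT⟩ : ∃ T : S →ₗᵢ[ℂ] K, ∀ i hi, T ⟨v i, hi⟩ = w i :=
    exists_isometry_range_of_gram_eq h
  -- Projecting onto the span of `v` before applying the Gram isometry defines `A` on all of `H`,
  -- which may be too large to embed in `K`.
  refine ⟨T.toContinuousLinearMap ∘L S.orthogonalProjectionOnto, fun u => ?_, fun i => ?_⟩
  · change ‖T (S.orthogonalProjectionOnto u)‖ ≤ _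
    rw [T.norm_map]
    exact S.norm_orthogonalProjectionOnto_apply_le u
  · have hi : v i ∈ S := ⟨Pi.single i 1, by simp⟩
    rw [← hT i hi]
    change T _ = T _
    congr 1
    exact S.orthogonalProjectionOnto_mem_subspace_eq_self ⟨v i, hi⟩

/-! ### Transfer between `H` and a copy of dimension `2m+1` -/

section Copy

variable {m : ℕ} {H : Type u} [NormedAddCommGroup H] [InnerProductSpace ℂ H] {K : Type*}
  [NormedAddCommGroup K] [InnerProductSpace ℂ K]

/-- With `none` standing for the state vector, the copy conditions become equality of two Gram
matrices of `m+1` vectors, the form required by the isometry lemmas. -/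
theorem IsCopy.gram_eq {ψ : H} {l : Fin m → H} {φ' : K} {l' : Fin m → K} (h : IsCopy l φ' l')
    (hψ : ‖ψ‖ = 1) (hl : ∀ j, inner ℂ (l j) ψ = (0 : ℂ)) (s t : Option (Fin m)) :
    inner ℂ (s.elim ψ l) (t.elim ψ l) = (inner ℂ (s.elim φ' l') (t.elim φ' l') : ℂ) := by
  rcases s with _ | i <;> rcases t with _ | j <;> simp only [Option.elim_none, Option.elim_some]
  · rw [h.1, inner_self_eq_norm_sq_to_K, hψ]
    simp
  · rw [h.2.1, ← inner_conj_symm, hl, map_zero]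
  · rw [hl, ← inner_conj_symm, h.2.1, map_zero]
  · rw [h.2.2]

open scoped ComplexOrder in
/-- Covariance matrices of locally unbiased measurements come from systems of vectors in a copy. -/
theorem covRegion_subset [FiniteDimensional ℂ K] (hK : Module.finrank ℂ K = 2 * m + 1)
    {θ : Fin m → ℝ} {ψ : H} {l : Fin m → H} {φ' : K} {l' : Fin m → K} (h : IsCopy l φ' l')
    (hψ : ‖ψ‖ = 1) (hl : ∀ j, inner ℂ (l j) ψ = (0 : ℂ)) :
    covRegion θ ψ l ⊆ vectorSystemRegion φ' l' := by
  rintro _ ⟨M, ⟨hfin, x, hx, hx0, hxl⟩, rfl⟩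
  -- The orthogonal components `z i` supply exactly the defect `V - X*X`, so `(x i, z i)` has Gram
  -- matrix `V`, while pairings with `(ψ, 0)` and `(l j, 0)` are unchanged.
  obtain ⟨r, z, hz⟩ := (POVM.posSemidef_cov_sub hfin hx).exists_inner_eq
  obtain ⟨y, hy, hyy⟩ := exists_extend_family (𝕜 := ℂ) (ι := Option (Fin m)) (κ := Fin m)
    (E := WithLp 2 (H × EuclideanSpace ℂ (Fin r))) (F := K) (by simp [hK]; omega)
    (fun s => WithLp.toLp 2 (s.elim ψ l, 0)) (fun i => WithLp.toLp 2 (x i, z i))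
    (w := fun s => s.elim φ' l') (fun s t => by
      rw [WithLp.prod_inner_apply]
      simpa using h.gram_eq hψ hl s t)
  have hyV : ∀ i j, inner ℂ (y i) (y j) = ((M.cov θ ψ i j : ℝ) : ℂ) := fun i j => by
    rw [hyy, WithLp.prod_inner_apply]
    simp [hz]
  refine ⟨y, fun i => ?_, fun i j => ?_, fun i j => ?_, ?_⟩
  · have := hy none i
    rw [WithLp.prod_inner_apply] at this
    rw [← inner_conj_symm]
    simp [hx0] at this
    simp [this]
  · rw [hyV, Complex.ofReal_im]
  · have := hy (some j) i
    rw [WithLp.prod_inner_apply] at this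
    simp at this
    rw [← inner_conj_symm, this, Complex.conj_re, hxl]
  · ext i j
    rw [Matrix.of_apply, hyV, Complex.ofReal_re]

end Copy
theorem POVM.isSimple_discrete {Ω : Type*} [MeasurableSpace Ω] {H : Type*} [NormedAddCommGroup H]
    [InnerProductSpace ℂ H] {ι : Type*} [Fintype ι] (p : ι → Ω) (A : ι → H →L[ℂ] H)
    (hA : ∀ k, (A k).IsPositive) (h1 : ∑ k, A k = 1) (hself : ∀ s, A s * A s = A s)
    (hne : ∀ s t, s ≠ t → A s * A t = 0) : (discrete p A hA h1).IsSimple := by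
  classical
  intro B _
  change (∑ s, if p s ∈ B then A s else 0) * (∑ s, if p s ∈ B then A s else 0) =
    ∑ s, if p s ∈ B then A s else 0
  rw [Finset.sum_mul_sum]
  refine Finset.sum_congr rfl fun s _ => ?_
  rw [Finset.sum_eq_single s]
  · split_ifs
    exacts [hself s, mul_zero _]
  · intro t _ hts
    split_ifs <;> simp [hne s t hts.symm]
  · simp

section Copy

variable {m : ℕ} {K : Type*} [NormedAddCommGroup K] [InnerProductSpace ℂ K]
  [FiniteDimensional ℂ K]

/-- Systems of vectors with real inner products in a space of dimension `2m+1` are realized by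
measurements with finitely many outcomes in every space that contracts to it. -/
theorem exists_discrete_of_mem_vectorSystemRegion (hK : Module.finrank ℂ K = 2 * m + 1)
    {H : Type*} [NormedAddCommGroup H] [InnerProductSpace ℂ H] [CompleteSpace H] (A : H →L[ℂ] K)
    (hA : ∀ v, ‖A v‖ ≤ ‖v‖) (θ : Fin m → ℝ) {ψ : H} {l : Fin m → H}
    (hψ : inner ℂ (A ψ) (A ψ) = (1 : ℂ)) {V : Matrix (Fin m) (Fin m) ℝ}
    (hV : V ∈ vectorSystemRegion (A ψ) fun j => A (l j)) :
    ∃ (e : OrthonormalBasis (Fin (2 * m + 1)) ℂ K) (p : Option (Fin (2 * m + 1)) → Fin m → ℝ)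
      (F : Option (Fin (2 * m + 1)) → H →L[ℂ] H)
      (hF : ∀ s, (F s).IsPositive) (h1 : ∑ s, F s = 1),
      (POVM.discrete p F hF h1).IsLocallyUnbiased θ ψ l ∧ (POVM.discrete p F hF h1).cov θ ψ = V ∧
      (∀ k u v, inner ℂ u (F (some k) v) = inner ℂ (A u) (e k) * inner ℂ (e k) (A v)) ∧
      ∀ u v, inner ℂ u (F none v) = inner ℂ u v - inner ℂ (A u) (A v) := by
  obtain ⟨x, hx0, him, hxl, rfl⟩ := hV
  have hx0' : ∀ i, inner ℂ (A ψ) (x i) = (0 : ℂ) := fun i => by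
    rw [← inner_conj_symm, hx0, map_zero]
  obtain ⟨e, a, r, ha, hφ, hx⟩ := exists_orthonormalBasis_real hK (by omega) hψ hx0' him
  obtain ⟨p, F, hF, h1, hlu, hcov, hsome, hnone⟩ :=
    POVM.exists_discrete_isLocallyUnbiased e A hA θ (l := l) ha hφ hx hx0' fun i j => by
      rw [← inner_conj_symm, Complex.conj_re, hxl]
  exact ⟨e, p, F, hF, h1, hlu, hcov, hsome, hnone⟩

/-- For the identity contraction the defect effect vanishes, and the remaining effects are the
orthogonal projections onto the lines of an orthonormal basis. -/
theorem exists_isSimple_of_mem_vectorSystemRegion (hK : Module.finrank ℂ K = 2 * m + 1)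
    (θ : Fin m → ℝ) {ψ : K} {l : Fin m → K} (hψ : inner ℂ ψ ψ = (1 : ℂ))
    {V : Matrix (Fin m) (Fin m) ℝ} (hV : V ∈ vectorSystemRegion ψ l) :
    ∃ E : POVM (Fin m → ℝ) K, E.IsSimple ∧ E.IsLocallyUnbiased θ ψ l ∧ E.cov θ ψ = V := by
  have : CompleteSpace K := FiniteDimensional.complete ℂ K
  obtain ⟨e, p, F, hF, h1, hlu, hcov, hsome, hnone⟩ :=
    exists_discrete_of_mem_vectorSystemRegion hK (ContinuousLinearMap.id ℂ K) (fun _ => le_rfl) θ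
      (l := l) hψ hV
  simp only [ContinuousLinearMap.id_apply] at hsome hnone
  have h0 : F none = 0 := by
    ext v
    refine ext_inner_left ℂ fun u => ?_
    rw [hnone, sub_self]
    simp
  refine ⟨_, POVM.isSimple_discrete p F hF h1 ?_ ?_, hlu, hcov⟩
  · rintro (_ | k)
    · rw [h0, mul_zero]
    · ext v
      refine ext_inner_left ℂ fun u => ?_
      rw [mul_apply_eq_comp, hsome, hsome, hsome,
        inner_self_eq_norm_sq_to_K, e.orthonormal.1]
      simp
  · rintro (_ | k) (_ | j) hst
    · exact absurd rfl hst
    · rw [h0, zero_mul]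
    · rw [h0, mul_zero]
    · ext v
      refine ext_inner_left ℂ fun u => ?_
      have hkj : k ≠ j := fun h => hst (by rw [h])
      rw [mul_apply_eq_comp, hsome, hsome, e.orthonormal.2 hkj]
      simp

end Copy

theorem exists_isCopy {m : ℕ} {H : Type*} [NormedAddCommGroup H] [InnerProductSpace ℂ H] {ψ : H}
    {l : Fin m → H} (hψ : ‖ψ‖ = 1) (hl : ∀ j, inner ℂ (l j) ψ = (0 : ℂ)) :
    ∃ (φ' : EuclideanSpace ℂ (Fin (2 * m + 1))) (l' : Fin m → EuclideanSpace ℂ (Fin (2 * m + 1))),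
      IsCopy l φ' l' := by
  -- No vector is prescribed here: all `m+1` are moved freely.
  obtain ⟨z, -, hz⟩ := exists_extend_family (𝕜 := ℂ) (ι := Empty) (κ := Option (Fin m))
    (F := EuclideanSpace ℂ (Fin (2 * m + 1))) (by simp; omega) Empty.elim
    (fun s => s.elim ψ l) (w := Empty.elim) (fun s => s.elim)
  refine ⟨z none, fun j => z (some j), ?_, fun j => ?_, fun i j => ?_⟩
  · rw [hz]
    simp [inner_self_eq_norm_sq_to_K, hψ]
  · rw [hz, Option.elim_none, Option.elim_some, ← inner_conj_symm, hl, map_zero]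
  · rw [hz, Option.elim_some, Option.elim_some]

end

end QEst

/-! ### The reduction theorem -/

theorem mainTheorem6 {m : ℕ} {H : Type*} [NormedAddCommGroup H] [InnerProductSpace ℂ H]
    [CompleteSpace H] (Θ : Set (Fin m → ℝ)) (hΘ : IsOpen Θ) (φ : (Fin m → ℝ) → H)
    (hφ : DifferentiableOn ℝ φ Θ) (hφ1 : ∀ η ∈ Θ, ‖φ η‖ = 1) (θ : Fin m → ℝ) (hθ : θ ∈ Θ) :
    -- the two forms of local unbiasedness agree
    (∀ M : QEst.POVM (Fin m → ℝ) H, M.HasLocallyBoundedSecondMoments φ θ →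
      (M.IsLocallyUnbiasedInMean φ θ ↔
        M.IsLocallyUnbiased θ (φ θ) (QEst.horizontalLift φ θ))) ∧
    -- copies of `φ` and the `l_i` exist in dimension `2m+1`
    (∃ (φ' : EuclideanSpace ℂ (Fin (2 * m + 1)))
      (l' : Fin m → EuclideanSpace ℂ (Fin (2 * m + 1))),
      QEst.IsCopy (QEst.horizontalLift φ θ) φ' l') ∧
    ∀ (K : Type*) [NormedAddCommGroup K] [InnerProductSpace ℂ K] (φ' : K) (l' : Fin m → K),
      Module.finrank ℂ K = 2 * m + 1 →
      QEst.IsCopy (QEst.horizontalLift φ θ) φ' l' →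
      -- reduction to simple measurements in `K`
      (∀ M : QEst.POVM (Fin m → ℝ) H,
        M.IsLocallyUnbiased θ (φ θ) (QEst.horizontalLift φ θ) →
        ∃ E : QEst.POVM (Fin m → ℝ) K, E.IsSimple ∧ E.IsLocallyUnbiased θ φ' l' ∧
          E.cov θ φ' = M.cov θ (φ θ)) ∧
      -- reduction of the determination of `𝒱` and of the minimization of `Tr G V`
      QEst.covRegion θ (φ θ) (QEst.horizontalLift φ θ) = QEst.vectorSystemRegion φ' l' ∧
      QEst.covRegionInMean φ θ = QEst.vectorSystemRegion φ' l' ∧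
      ∀ (G : Matrix (Fin m) (Fin m) ℝ), G.PosSemidef → ∀ c : ℝ,
        (IsLeast ((fun V => (G * V).trace) ''
            QEst.covRegion θ (φ θ) (QEst.horizontalLift φ θ)) c ↔
          IsLeast ((fun V => (G * V).trace) '' QEst.vectorSystemRegion φ' l') c) := by
  have hnhds : Θ ∈ 𝓝 θ := hΘ.mem_nhds hθ
  have hd : DifferentiableAt ℝ φ θ := hφ.differentiableAt hnhds
  have h1 : ∀ᶠ η in 𝓝 θ, ‖φ η‖ = 1 := Filter.mem_of_superset hnhds hφ1
  have hn := hφ1 θ hθ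
  have hl : ∀ j, inner ℂ (QEst.horizontalLift φ θ j) (φ θ) = (0 : ℂ) := fun j =>
    QEst.inner_horizontalLift φ θ j hn
  have hiff : ∀ M : QEst.POVM (Fin m → ℝ) H, M.HasLocallyBoundedSecondMoments φ θ →
      (M.IsLocallyUnbiasedInMean φ θ ↔
        M.IsLocallyUnbiased θ (φ θ) (QEst.horizontalLift φ θ)) :=
    fun M hM => QEst.POVM.isLocallyUnbiasedInMean_iff hd h1 hM
  refine ⟨hiff, QEst.exists_isCopy hn hl, ?_⟩
  intro K _ _ φ' l' hK hcopy
  -- `finrank` is 0 in infinite dimension, so the value `2m+1` forces finite dimension.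
  have : FiniteDimensional ℂ K := FiniteDimensional.of_finrank_pos (by omega)
  have hsub := QEst.covRegion_subset (θ := θ) hK hcopy hn hl
  -- Together with `hsub` and `hsup` this closes a cycle of inclusions, so the three regions
  -- coincide.
  have hsub' : QEst.covRegionInMean φ θ ⊆
      QEst.covRegion θ (φ θ) (QEst.horizontalLift φ θ) := by
    rintro V ⟨M, hM, hlu, hV⟩
    exact ⟨M, (hiff M hM).1 hlu, hV⟩
  have hsup : QEst.vectorSystemRegion φ' l' ⊆ QEst.covRegionInMean φ θ := by
    intro V hV
    obtain ⟨A, hA, hAv⟩ := QEst.exists_contraction_of_gram_eq (hcopy.gram_eq hn hl)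
    have hAψ : A (φ θ) = φ' := hAv none
    have hAl : (fun j => A (QEst.horizontalLift φ θ j)) = l' := funext fun j => hAv (some j)
    rw [← hAψ, ← hAl] at hV
    obtain ⟨e, p, F, hF, hF1, hlu, hcov, -, -⟩ :=
      QEst.exists_discrete_of_mem_vectorSystemRegion hK A hA θ (by rw [hAψ]; exact hcopy.1) hV
    have hM := QEst.POVM.hasLocallyBoundedSecondMoments_discrete p F hF hF1 h1
    exact ⟨_, hM, (hiff _ hM).2 hlu, hcov⟩
  have heq : QEst.covRegion θ (φ θ) (QEst.horizontalLift φ θ) = QEst.vectorSystemRegion φ' l' :=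
    hsub.antisymm (hsup.trans hsub')
  refine ⟨fun M hM => ?_, heq, (hsub'.trans hsub).antisymm hsup, fun G _ c => by rw [heq]⟩
  exact QEst.exists_isSimple_of_mem_vectorSystemRegion hK θ hcopy.1 (hsub ⟨M, hM, rfl⟩)
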